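/- Let $\mathbf C^+=\{z\in\mathbf C : \operatorname{Im} z>0\}$. A Nevanlinna function is an analytic function $\psi$ on $\mathbf C^+$ with $\operatorname{Im}\psi(z)\le 0$ for all $z\in\mathbf C^+$. A domain (nonempty connected open set) $\Omega\subset\mathbf C$ is called starlike at $-\infty$ if $\Omega\neq\mathbf C$ and $\Omega-t\subset\Omega$ for every real $t>0$. Let $\psi$ be a Nevanlinna function that is not identically zero, and let $\Psi$ be a primitive of $-\psi$ on $\mathbf C^+$, that is, a holomorphic function on $\mathbf C^+$ with $\Psi'=-\psi$. Then $\Psi(\mathbf C^+)$ is a domain starlike at $-\infty$. Conversely, for any domain $\Omega$ starlike at $-\infty$ there exist a Nevanlinna function $\psi$, not identically zero, and a primitive $\Psi$ of $-\psi$ on $\mathbf C^+$ such that $\Omega=\Psi(\mathbf C^+)$. -/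

import Mathlib

/-- A Nevanlinna function: analytic on the open upper half-plane, with values in the union of the
open lower half-plane and the real line. (The values of `φ` off the upper half-plane are
irrelevant.) -/
structure IsNevanlinna (φ : ℂ → ℂ) : Prop where
  analytic : AnalyticOnNhd ℂ φ UpperHalfPlane.upperHalfPlaneSet
  im_nonpos : ∀ z ∈ UpperHalfPlane.upperHalfPlaneSet, (φ z).im ≤ 0

/-- `F` is a (holomorphic) primitive of `f` on the open upper half-plane. -/
def IsPrimitiveOnUpperHalf (F f : ℂ → ℂ) : Prop :=
  ∀ z ∈ UpperHalfPlane.upperHalfPlaneSet, HasDerivAt F (f z) z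

/-- A domain of the complex plane (open and connected, in particular nonempty) which is not the
whole plane and is mapped into itself by all translations `w ↦ w - t`, `t > 0`. -/
structure IsStarlikeAtNegInfty (Ω : Set ℂ) : Prop where
  isOpen : IsOpen Ω
  isConnected : IsConnected Ω
  ne_univ : Ω ≠ Set.univ
  sub_subset : ∀ t : ℝ, 0 < t → (fun w : ℂ => w - (t : ℂ)) '' Ω ⊆ Ω

open Complex Metric Set Filter Topology ComplexConjugate

/-! Direct half. By the open mapping theorem `ψ` is a nonzero real constant or has values in the
open lower half-plane. So `Ψ' = -ψ` lies in a half-plane bounded by a line through `0`, and `Ψ` is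
injective (`injOn_of_re_mul_deriv_pos`); its image is not the plane, by Liouville applied to the
inverse. The leftward ray `w - s` lifts under `Ψ` to a solution of `z' = 1 / ψ(z)`, and the point is
that this flow exists for all `s ≥ 0`. Since `Im (1 / ψ) ≥ 0`, `Im z` does not decrease. The
Schwarz–Pick inequality `|ψ'| Im z ≤ -Im ψ` makes `|ψ| Im z` nondecreasing along the flow, so the
speed is at most `Im z / c` and `z` stays in a compact set for bounded times
(`IsNevanlinna.exists_bound_of_hasDerivAt_inv`).

Converse half. `Ω` is simply connected and omits a ray, so it has a Riemann map `G` onto the disc.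
There the translations `w ↦ w - t` become holomorphic self-maps whose orbits tend to the circle.
Wolff's argument gives a boundary point `τ` whose horodiscs are all invariant, and compactness of
the circle gives one `τ` for all times `2⁻ʲ` (`IsStarlikeAtNegInfty.exists_wolff_point`). A Cayley
transform sending `τ` to `∞` turns horodiscs into half-planes `Im > const`. The resulting conformal
map `g` of `Ω` onto the upper half-plane satisfies `Im g(w - t) ≥ Im g(w)` at these times, hence `Im
g' ≤ 0`. Then `Ψ = g⁻¹` has `-Ψ' = -1 / g'`, again with nonpositive imaginary part. -/

/-! ### Disc automorphisms and the Schwarz–Pick lemma -/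

/-- The automorphism of the unit disc that sends `a` to `0`. -/
noncomputable def discAut (a z : ℂ) : ℂ := (z - a) / (1 - conj a * z)

lemma one_sub_conj_mul_ne_zero {a z : ℂ} (ha : ‖a‖ < 1) (hz : ‖z‖ < 1) :
    1 - conj a * z ≠ 0 := by
  intro h
  have h1 : conj a * z = 1 := (sub_eq_zero.mp h).symm
  have h2 : ‖a‖ * ‖z‖ = 1 := by simpa using congrArg norm h1
  nlinarith [norm_nonneg a, norm_nonneg z]

/-- Rests on `|1 - āz|² - |z - a|² = (1 - |a|²)(1 - |z|²)`. It gives invariance of the disc and,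
later, the horodisc form of Schwarz–Pick. -/
lemma one_sub_normSq_discAut {a z : ℂ} (ha : ‖a‖ < 1) (hz : ‖z‖ < 1) :
    1 - normSq (discAut a z) =
      (1 - normSq a) * (1 - normSq z) / normSq (1 - conj a * z) := by
  have h := one_sub_conj_mul_ne_zero ha hz
  have h' : normSq (1 - conj a * z) ≠ 0 := by simpa using h
  rw [discAut, normSq_div, eq_div_iff h', sub_mul, div_mul_cancel₀ _ h']
  simp [normSq_apply]
  ring

lemma normSq_lt_one_iff {z : ℂ} : normSq z < 1 ↔ ‖z‖ < 1 := by
  rw [normSq_eq_norm_sq, sq_lt_one_iff₀ (norm_nonneg z)]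

lemma norm_discAut_lt_one {a z : ℂ} (ha : ‖a‖ < 1) (hz : ‖z‖ < 1) : ‖discAut a z‖ < 1 := by
  rw [← normSq_lt_one_iff, ← sub_pos, one_sub_normSq_discAut ha hz]
  have h1 := normSq_lt_one_iff.2 ha
  have h2 := normSq_lt_one_iff.2 hz
  have h3 : 0 < normSq (1 - conj a * z) := normSq_pos.2 (one_sub_conj_mul_ne_zero ha hz)
  have h4 : 0 < 1 - normSq a := by linarith
  have h5 : 0 < 1 - normSq z := by linarith
  positivity

@[simp] lemma discAut_self (a : ℂ) : discAut a a = 0 := by simp [discAut]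

@[simp] lemma discAut_neg_zero (a : ℂ) : discAut (-a) 0 = a := by simp [discAut]

lemma discAut_neg_discAut {a z : ℂ} (ha : ‖a‖ < 1) (hz : ‖z‖ < 1) :
    discAut (-a) (discAut a z) = z := by
  have h := one_sub_conj_mul_ne_zero ha hz
  have h' := one_sub_conj_mul_ne_zero (a := -a) (by simpa using ha) (norm_discAut_lt_one ha hz)
  rw [discAut, div_eq_iff h']
  have h2 : discAut a z * (1 - conj a * z) = z - a := div_mul_cancel₀ _ h
  simp only [map_neg]
  linear_combination h2

lemma hasDerivAt_discAut {a z : ℂ} (ha : ‖a‖ < 1) (hz : ‖z‖ < 1) :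
    HasDerivAt (discAut a) ((1 - conj a * a) / (1 - conj a * z) ^ 2) z := by
  have h := one_sub_conj_mul_ne_zero ha hz
  have h1 : HasDerivAt (fun z : ℂ => z - a) 1 z := (hasDerivAt_id z).sub_const a
  have h2 : HasDerivAt (fun z : ℂ => 1 - conj a * z) (-(conj a * 1)) z :=
    ((hasDerivAt_id z).const_mul (conj a)).const_sub 1
  convert! h1.div h2 h using 1
  ring

lemma discAut_injOn {a : ℂ} (ha : ‖a‖ < 1) : InjOn (discAut a) (ball 0 1) := by
  intro z hz w hw h
  rw [mem_ball_zero_iff] at hz hw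
  rw [← discAut_neg_discAut ha hz, h, discAut_neg_discAut ha hw]

lemma one_sub_conj_mul_self_ne_zero {a : ℂ} (ha : ‖a‖ < 1) : 1 - conj a * a ≠ 0 :=
  one_sub_conj_mul_ne_zero ha ha

/-- The **Schwarz–Pick lemma** in the unit disc. -/
theorem norm_discAut_map_le {h : ℂ → ℂ} (hd : DifferentiableOn ℂ h (ball 0 1))
    (hm : MapsTo h (ball 0 1) (ball 0 1)) {a z : ℂ} (ha : ‖a‖ < 1) (hz : ‖z‖ < 1) :
    ‖discAut (h a) (h z)‖ ≤ ‖discAut a z‖ := by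
  have hm' : ∀ w : ℂ, ‖w‖ < 1 → ‖h w‖ < 1 := fun w hw => by simpa using hm (by simpa using hw)
  have ha' : ‖-a‖ < 1 := by simpa using ha
  -- Conjugating by automorphisms moves `a` and `h a` to `0`, where the Schwarz lemma applies.
  let f : ℂ → ℂ := fun w => discAut (h a) (h (discAut (-a) w))
  have hf : DifferentiableOn ℂ f (ball 0 1) := by
    intro w hw
    rw [mem_ball_zero_iff] at hw
    have h1 := norm_discAut_lt_one ha' hw
    refine DifferentiableAt.differentiableWithinAt ?_
    refine DifferentiableAt.comp (f := fun w => h (discAut (-a) w)) w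
      (hasDerivAt_discAut (hm' a ha) (hm' _ h1)).differentiableAt ?_
    refine DifferentiableAt.comp w ?_ (hasDerivAt_discAut ha' hw).differentiableAt
    exact hd.differentiableAt (isOpen_ball.mem_nhds (by simpa using h1))
  have hfm : MapsTo f (ball 0 1) (closedBall 0 1) := by
    intro w hw
    rw [mem_ball_zero_iff] at hw
    rw [mem_closedBall_zero_iff]
    exact (norm_discAut_lt_one (hm' a ha) (hm' _ (norm_discAut_lt_one ha' hw))).le
  have := Complex.norm_le_norm_of_mapsTo_ball hf hfm (by simp [f]) (norm_discAut_lt_one ha hz)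
  simpa [f, discAut_neg_discAut ha hz] using this

/-- The infinitesimal **Schwarz–Pick lemma** in the upper half-plane. -/
theorem norm_deriv_mul_im_le_im {h : ℂ → ℂ}
    (hd : DifferentiableOn ℂ h UpperHalfPlane.upperHalfPlaneSet)
    (hm : MapsTo h UpperHalfPlane.upperHalfPlaneSet UpperHalfPlane.upperHalfPlaneSet) {a : ℂ}
    (ha : a ∈ UpperHalfPlane.upperHalfPlaneSet) : ‖deriv h a‖ * a.im ≤ (h a).im := by
  have hb : 0 < (h a).im := hm ha
  have ha0 : 0 < a.im := ha
  set b := h a with hbdef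
  -- `p` maps the disc to the half-plane with `0 ↦ a`, and `q` maps the half-plane to the disc with
  -- `b ↦ 0`. The claim is `|(q ∘ h ∘ p)'(0)| ≤ 1` written out.
  let p : ℂ → ℂ := fun z => (a - conj a * z) / (1 - z)
  let q : ℂ → ℂ := fun w => (w - b) / (w - conj b)
  have hp1 : ∀ z : ℂ, ‖z‖ < 1 → 1 - z ≠ 0 := by
    intro z hz h0
    rw [← sub_eq_zero.mp h0] at hz
    simp at hz
  have hp : ∀ z : ℂ, ‖z‖ < 1 → 0 < (p z).im := by
    intro z hz
    have h2 : (p z).im = a.im * (1 - normSq z) / normSq (1 - z) := by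
      have := normSq_pos.2 (hp1 z hz)
      simp only [p, div_im]
      field_simp
      simp [normSq_apply]
      ring
    rw [h2]
    have h3 := normSq_lt_one_iff.2 hz
    have h5 : 0 < 1 - normSq z := by linarith
    have := normSq_pos.2 (hp1 z hz)
    positivity
  have hpd : ∀ z : ℂ, ‖z‖ < 1 → HasDerivAt p ((a - conj a) / (1 - z) ^ 2) z := by
    intro z hz
    have h1 : HasDerivAt (fun z : ℂ => a - conj a * z) (-(conj a * 1)) z :=
      ((hasDerivAt_id z).const_mul (conj a)).const_sub a
    have h2 : HasDerivAt (fun z : ℂ => 1 - z) (-1) z := (hasDerivAt_id z).const_sub 1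
    convert! h1.div h2 (hp1 z hz) using 1
    ring
  have hq1 : ∀ w : ℂ, 0 < w.im → w - conj b ≠ 0 := by
    intro w hw h0
    have := congrArg im h0
    simp at this
    linarith
  have hqd : ∀ w : ℂ, 0 < w.im → HasDerivAt q ((b - conj b) / (w - conj b) ^ 2) w := by
    intro w hw
    have h1 : HasDerivAt (fun w : ℂ => w - b) 1 w := (hasDerivAt_id w).sub_const b
    have h2 : HasDerivAt (fun w : ℂ => w - conj b) 1 w := (hasDerivAt_id w).sub_const _
    convert! h1.div h2 (hq1 w hw) using 1
    ring
  have hq : ∀ w : ℂ, 0 < w.im → ‖q w‖ ≤ 1 := by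
    intro w hw
    have h1 : 0 < normSq (w - conj b) := normSq_pos.2 (hq1 w hw)
    have : normSq (q w) ≤ 1 := by
      rw [normSq_div, div_le_one h1]
      simp [normSq_apply]
      nlinarith
    rwa [normSq_eq_norm_sq, sq_le_one_iff₀ (norm_nonneg _)] at this
  have hp0 : p 0 = a := by simp [p]
  let f : ℂ → ℂ := fun z => q (h (p z))
  have hhd : ∀ w : ℂ, 0 < w.im → DifferentiableAt ℂ h w := fun w hw =>
    hd.differentiableAt (UpperHalfPlane.isOpen_upperHalfPlaneSet.mem_nhds hw)
  have hf : DifferentiableOn ℂ f (ball 0 1) := by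
    intro z hz
    rw [mem_ball_zero_iff] at hz
    refine DifferentiableAt.differentiableWithinAt ?_
    refine DifferentiableAt.comp (f := fun z => h (p z)) z (hqd _ (hm (hp z hz))).differentiableAt ?_
    exact DifferentiableAt.comp z (hhd _ (hp z hz)) (hpd z hz).differentiableAt
  have hf0 : f 0 = 0 := by simp [f, hp0, q, b]
  have hfm : MapsTo f (ball 0 1) (closedBall (f 0) 1) := by
    intro z hz
    rw [mem_ball_zero_iff] at hz
    rw [hf0, mem_closedBall_zero_iff]
    exact hq _ (hm (hp z hz))
  have key := Complex.norm_deriv_le_one_of_mapsTo_ball hf hfm one_pos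
  have hder : HasDerivAt f ((b - conj b) / (b - conj b) ^ 2 * (deriv h a * (a - conj a))) 0 := by
    have e1 := hpd 0 (by simp)
    have e2 := (hhd a ha).hasDerivAt
    have e3 := hqd b hb
    rw [sub_zero, one_pow, div_one] at e1
    rw [← hp0] at e2
    have e4 := e2.comp (0 : ℂ) e1
    have e5 : HasDerivAt q ((b - conj b) / (b - conj b) ^ 2) ((h ∘ p) 0) := by
      simpa [hp0] using e3
    have := e5.comp (0 : ℂ) e4
    simpa only [hp0] using! this
  rw [hder.deriv] at key
  have hbb : ‖b - conj b‖ = 2 * b.im := by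
    rw [sub_conj]; simp [abs_of_pos hb]
  have haa : ‖a - conj a‖ = 2 * a.im := by
    rw [sub_conj]; simp [abs_of_pos ha0]
  rw [norm_mul, norm_div, norm_pow, norm_mul, hbb, haa] at key
  have : 2 * b.im / (2 * b.im) ^ 2 * (‖deriv h a‖ * (2 * a.im)) = ‖deriv h a‖ * a.im / b.im := by
    field_simp
  rw [this, div_le_one hb] at key
  exact key

/-! ### Injectivity, holomorphic inverses and Liouville -/

/-- A **Noshiro–Warschawski** criterion: on a convex set, a function whose derivative takes its
values in an open half-plane bounded by a line through `0` is injective. -/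
theorem injOn_of_re_mul_deriv_pos {S : Set ℂ} (hS : Convex ℝ S) {F F' : ℂ → ℂ}
    (hF : ∀ z ∈ S, HasDerivAt F (F' z) z) {u : ℂ} (hu : ∀ z ∈ S, 0 < (u * F' z).re) :
    InjOn F S := by
  intro a ha b hb hab
  by_contra hne
  have hba : b - a ≠ 0 := sub_ne_zero.2 (Ne.symm hne)
  have hmem : ∀ t ∈ Icc (0 : ℝ) 1, a + t * (b - a) ∈ S := by
    intro t ht
    have := hS.add_smul_sub_mem ha hb ht
    simpa using this
  -- The factor `u / (b - a)` cancels the chain-rule factor of the segment, so `k' = Re (u F') > 0`,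
  -- whereas `F a = F b` gives `k 0 = k 1`.
  let k : ℝ → ℝ := fun t => (u / (b - a) * F (a + t * (b - a))).re
  have hk : ∀ t ∈ Icc (0 : ℝ) 1, HasDerivAt k (u * F' (a + t * (b - a))).re t := by
    intro t ht
    have h1 : HasDerivAt (fun s : ℂ => a + s * (b - a)) (b - a) (t : ℂ) := by
      simpa using ((hasDerivAt_id (t : ℂ)).mul_const (b - a)).const_add a
    have h2 := ((hF _ (hmem t ht)).comp (t : ℂ) h1).const_mul (u / (b - a))
    have h3 : u / (b - a) * (F' (a + t * (b - a)) * (b - a)) = u * F' (a + t * (b - a)) := by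
      field_simp
    rw [h3] at h2
    exact h2.real_of_complex
  obtain ⟨t, ht, hkt⟩ := exists_hasDerivAt_eq_slope k _ one_pos
    (fun t ht => (hk t ht).continuousAt.continuousWithinAt)
    (fun t ht => hk t (Ioo_subset_Icc_self ht))
  have h01 : k 1 - k 0 = 0 := by simp [k, hab]
  rw [h01, zero_div] at hkt
  exact (hu _ (hmem t (Ioo_subset_Icc_self ht))).ne' hkt

lemma hasStrictDerivAt_of_isOpen {U : Set ℂ} (hU : IsOpen U) {F F' : ℂ → ℂ}
    (hF : ∀ z ∈ U, HasDerivAt F (F' z) z) {z : ℂ} (hz : z ∈ U) :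
    HasStrictDerivAt F (F' z) z := by
  have h1 : DifferentiableOn ℂ F U := fun w hw => (hF w hw).differentiableAt.differentiableWithinAt
  have h2 := (h1.analyticAt (hU.mem_nhds hz)).hasStrictDerivAt
  rwa [(hF z hz).deriv] at h2

lemma image_mem_nhds_of_deriv_ne_zero {U V : Set ℂ} (hU : IsOpen U) {F F' : ℂ → ℂ}
    (hF : ∀ z ∈ U, HasDerivAt F (F' z) z) (h0 : ∀ z ∈ U, F' z ≠ 0) {z : ℂ} (hz : z ∈ U)
    (hV : V ∈ 𝓝 z) : F '' V ∈ 𝓝 (F z) := by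
  rw [← (hasStrictDerivAt_of_isOpen hU hF hz).map_nhds_eq (h0 z hz)]
  exact image_mem_map hV

lemma isOpen_image_of_deriv_ne_zero {U : Set ℂ} (hU : IsOpen U) {F F' : ℂ → ℂ}
    (hF : ∀ z ∈ U, HasDerivAt F (F' z) z) (h0 : ∀ z ∈ U, F' z ≠ 0) : IsOpen (F '' U) := by
  rw [isOpen_iff_mem_nhds]
  rintro _ ⟨z, hz, rfl⟩
  exact image_mem_nhds_of_deriv_ne_zero hU hF h0 hz (hU.mem_nhds hz)

/-- The inverse of an injective holomorphic function with zero-free derivative. -/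
lemma hasDerivAt_invFunOn {U : Set ℂ} (hU : IsOpen U) {F F' : ℂ → ℂ}
    (hF : ∀ z ∈ U, HasDerivAt F (F' z) z) (h0 : ∀ z ∈ U, F' z ≠ 0) (hinj : InjOn F U)
    {z : ℂ} (hz : z ∈ U) : HasDerivAt (Function.invFunOn F U) (F' z)⁻¹ (F z) := by
  have hleft : ∀ w ∈ U, Function.invFunOn F U (F w) = w := fun w hw => hinj.leftInvOn_invFunOn hw
  have hopen := isOpen_image_of_deriv_ne_zero hU hF h0
  refine HasDerivAt.of_local_left_inverse (f := F) ?_ ?_ (h0 z hz) ?_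
  · rw [ContinuousAt, hleft z hz]
    intro V hV
    rw [mem_map]
    refine mem_of_superset
      (image_mem_nhds_of_deriv_ne_zero hU hF h0 hz (inter_mem hV (hU.mem_nhds hz))) ?_
    rintro _ ⟨w, hw, rfl⟩
    rw [mem_preimage, hleft w hw.2]
    exact hw.1
  · rw [hleft z hz]
    exact hF z hz
  · filter_upwards [hopen.mem_nhds (mem_image_of_mem F hz)] with y hy
    exact Function.invFunOn_eq hy

lemma convex_upperHalfPlaneSet : Convex ℝ UpperHalfPlane.upperHalfPlaneSet :=
  convex_halfSpace_im_gt 0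

lemma isConnected_upperHalfPlaneSet : IsConnected UpperHalfPlane.upperHalfPlaneSet :=
  ⟨⟨I, by simp [UpperHalfPlane.upperHalfPlaneSet]⟩, convex_upperHalfPlaneSet.isPreconnected⟩

/-- The image of the upper half-plane under an injective holomorphic function with zero-free
derivative is not the whole plane. -/
lemma image_upperHalfPlaneSet_ne_univ {F F' : ℂ → ℂ}
    (hF : ∀ z ∈ UpperHalfPlane.upperHalfPlaneSet, HasDerivAt F (F' z) z)
    (h0 : ∀ z ∈ UpperHalfPlane.upperHalfPlaneSet, F' z ≠ 0)
    (hinj : InjOn F UpperHalfPlane.upperHalfPlaneSet) :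
    F '' UpperHalfPlane.upperHalfPlaneSet ≠ univ := by
  intro huniv
  set G := Function.invFunOn F UpperHalfPlane.upperHalfPlaneSet with hG
  have hmem : ∀ w : ℂ, 0 < (G w).im := fun w =>
    Function.invFunOn_mem (show w ∈ F '' UpperHalfPlane.upperHalfPlaneSet from huniv ▸ mem_univ w)
  have hFG : ∀ w : ℂ, F (G w) = w := fun w =>
    Function.invFunOn_eq (show w ∈ F '' UpperHalfPlane.upperHalfPlaneSet from huniv ▸ mem_univ w)
  have hGd : Differentiable ℂ G := fun w => by
    have := hasDerivAt_invFunOn UpperHalfPlane.isOpen_upperHalfPlaneSet hF h0 hinj (hmem w)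
    rw [hFG w] at this
    exact this.differentiableAt
  -- `G` has values in the upper half-plane, so `|G + I| > 1` and the reciprocal is a bounded entire
  -- function.
  have hE : Differentiable ℂ fun w => (G w + I)⁻¹ := by
    refine Differentiable.inv (hGd.add_const I) fun w h => ?_
    have h1 := congrArg im h
    have h2 := hmem w
    simp at h1
    linarith
  have hb : Bornology.IsBounded (range fun w => (G w + I)⁻¹) := by
    refine (Metric.isBounded_closedBall (x := (0 : ℂ)) (r := 1)).subset ?_
    rintro _ ⟨w, rfl⟩
    rw [mem_closedBall_zero_iff, norm_inv]
    apply inv_le_one_of_one_le₀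
    have h1 : (G w + I).im ≤ ‖G w + I‖ := (le_abs_self _).trans (abs_im_le_norm _)
    have h2 := hmem w
    simp at h1
    linarith
  have h := hE.apply_eq_apply_of_bounded hb 0 1
  have hG01 : G 0 = G 1 := by simpa using h
  have := congrArg F hG01
  rw [hFG, hFG] at this
  exact zero_ne_one this

/-! ### Nevanlinna functions and the flow of `1 / ψ` -/

lemma IsNevanlinna.eq_const_or_im_neg {ψ : ℂ → ℂ} (h : IsNevanlinna ψ) :
    (∃ c : ℝ, ∀ z ∈ UpperHalfPlane.upperHalfPlaneSet, ψ z = c) ∨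
      ∀ z ∈ UpperHalfPlane.upperHalfPlaneSet, (ψ z).im < 0 := by
  -- A nonconstant `ψ` has open image, which lies in the interior of the closed lower half-plane.
  rcases h.analytic.is_constant_or_isOpen isConnected_upperHalfPlaneSet.isPreconnected with
    ⟨w, hw⟩ | ho
  · have hI : I ∈ UpperHalfPlane.upperHalfPlaneSet := by simp [UpperHalfPlane.upperHalfPlaneSet]
    have h1 := h.im_nonpos I hI
    rw [hw I hI] at h1
    rcases h1.lt_or_eq with h2 | h2
    · exact Or.inr fun z hz => by rwa [hw z hz]
    · refine Or.inl ⟨w.re, fun z hz => ?_⟩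
      rw [hw z hz]
      apply Complex.ext <;> simp [h2]
  · refine Or.inr fun z hz => ?_
    have h1 := ho _ Subset.rfl UpperHalfPlane.isOpen_upperHalfPlaneSet
    have h2 : ψ '' UpperHalfPlane.upperHalfPlaneSet ⊆ interior {w : ℂ | w.im ≤ 0} := by
      apply interior_maximal _ h1
      rintro _ ⟨z, hz, rfl⟩
      exact h.im_nonpos z hz
    rw [interior_setOfPred_im_le] at h2
    exact h2 (mem_image_of_mem ψ hz)

/-- Schwarz–Pick for `-ψ`, a self-map of the upper half-plane unless `ψ` is a real constant; in that
case the derivative vanishes. -/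
lemma IsNevanlinna.norm_deriv_mul_im_le {ψ : ℂ → ℂ} (h : IsNevanlinna ψ) {z : ℂ}
    (hz : z ∈ UpperHalfPlane.upperHalfPlaneSet) : ‖deriv ψ z‖ * z.im ≤ -(ψ z).im := by
  rcases h.eq_const_or_im_neg with ⟨c, hc⟩ | hneg
  · have h1 : ψ =ᶠ[𝓝 z] fun _ => (c : ℂ) := by
      filter_upwards [UpperHalfPlane.isOpen_upperHalfPlaneSet.mem_nhds hz] with w hw
      exact hc w hw
    rw [h1.deriv_eq, hc z hz]
    simp
  · have := norm_deriv_mul_im_le_im (h := fun z => -ψ z) h.analytic.differentiableOn.fun_neg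
      (fun w hw => by simpa [UpperHalfPlane.upperHalfPlaneSet] using hneg w hw) hz
    simpa using this

lemma HasDerivAt.complex_im {p : ℝ → ℂ} {p' : ℂ} {s : ℝ} (h : HasDerivAt p p' s) :
    HasDerivAt (fun s => (p s).im) p'.im s :=
  imCLM.hasFDerivAt.comp_hasDerivAt s h

lemma HasDerivAt.complex_re {p : ℝ → ℂ} {p' : ℂ} {s : ℝ} (h : HasDerivAt p p' s) :
    HasDerivAt (fun s => (p s).re) p'.re s :=
  reCLM.hasFDerivAt.comp_hasDerivAt s h

lemma monotoneOn_Ico_of_hasDerivAt {f f' : ℝ → ℝ} {T : ℝ}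
    (hf : ∀ s ∈ Ico 0 T, HasDerivAt f (f' s) s) (h0 : ∀ s ∈ Ico 0 T, 0 ≤ f' s) :
    MonotoneOn f (Ico 0 T) := by
  refine monotoneOn_of_deriv_nonneg (convex_Ico 0 T)
    (fun s hs => (hf s hs).continuousAt.continuousWithinAt)
    (fun s hs => (hf s (interior_subset hs)).differentiableAt.differentiableWithinAt)
    (fun s hs => ?_)
  rw [(hf s (interior_subset hs)).deriv]
  exact h0 s (interior_subset hs)

/-- Trajectories of the vector field `1 / ψ`, where `ψ` is a zero-free Nevanlinna function, stay in
compact subsets of the upper half-plane for bounded times. -/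
lemma IsNevanlinna.exists_bound_of_hasDerivAt_inv {ψ : ℂ → ℂ} (h : IsNevanlinna ψ)
    (h0 : ∀ z ∈ UpperHalfPlane.upperHalfPlaneSet, ψ z ≠ 0) {z : ℝ → ℂ} {T : ℝ} (hT : 0 < T)
    (hz : ∀ s ∈ Ico 0 T, z s ∈ UpperHalfPlane.upperHalfPlaneSet)
    (hd : ∀ s ∈ Ico 0 T, HasDerivAt z (ψ (z s))⁻¹ s) :
    ∃ R, ∀ s ∈ Ico 0 T, (z 0).im ≤ (z s).im ∧ ‖z s - z 0‖ ≤ R := by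
  have h0T : (0 : ℝ) ∈ Ico 0 T := ⟨le_rfl, hT⟩
  have hpos : ∀ s ∈ Ico 0 T, 0 < (z s).im := hz
  have hn : ∀ s ∈ Ico 0 T, 0 < normSq (ψ (z s)) := fun s hs => normSq_pos.2 (h0 _ (hz s hs))
  have hy : ∀ s ∈ Ico 0 T, HasDerivAt (fun s => (z s).im) (-(ψ (z s)).im / normSq (ψ (z s))) s :=
    fun s hs => by simpa only [inv_im] using (hd s hs).complex_im
  have hy0 : ∀ s ∈ Ico 0 T, 0 ≤ -(ψ (z s)).im / normSq (ψ (z s)) := fun s hs =>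
    div_nonneg (by linarith [h.im_nonpos _ (hz s hs)]) (hn s hs).le
  have hmono : ∀ s ∈ Ico 0 T, (z 0).im ≤ (z s).im := fun s hs =>
    monotoneOn_Ico_of_hasDerivAt hy hy0 h0T hs hs.1
  have hp : ∀ s ∈ Ico 0 T, HasDerivAt (fun s => ψ (z s)) (deriv ψ (z s) * (ψ (z s))⁻¹) s :=
    fun s hs => HasDerivAt.comp (h₂ := ψ) s
      (h.analytic _ (hz s hs)).differentiableAt.hasDerivAt (hd s hs)
  -- `N = (|ψ| Im z)²`. Its derivative is `2 Im z (A Im z - Im ψ)`, where `A` is half the derivative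
  -- of `|ψ|²`. Since `A ≥ -|ψ'|`, Schwarz–Pick makes this nonnegative.
  let N : ℝ → ℝ := fun s =>
    ((ψ (z s)).re * (ψ (z s)).re + (ψ (z s)).im * (ψ (z s)).im) * ((z s).im * (z s).im)
  have hN : MonotoneOn N (Ico 0 T) := by
    refine monotoneOn_Ico_of_hasDerivAt (fun s hs =>
      (((hp s hs).complex_re.mul (hp s hs).complex_re).add
        ((hp s hs).complex_im.mul (hp s hs).complex_im)).mul ((hy s hs).mul (hy s hs))) ?_
    intro s hs
    have hpick := h.norm_deriv_mul_im_le (hz s hs)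
    have hns := hn s hs
    have hys := hpos s hs
    have h1 : -‖deriv ψ (z s)‖ ≤ (ψ (z s)).re * (deriv ψ (z s) * (ψ (z s))⁻¹).re +
        (ψ (z s)).im * (deriv ψ (z s) * (ψ (z s))⁻¹).im := by
      have e1 : (ψ (z s)).re * (deriv ψ (z s) * (ψ (z s))⁻¹).re +
        (ψ (z s)).im * (deriv ψ (z s) * (ψ (z s))⁻¹).im =
          (conj (ψ (z s)) * (deriv ψ (z s) * (ψ (z s))⁻¹)).re := by
        rw [mul_re (conj _), conj_re, conj_im]; ring
      have e2 : ‖conj (ψ (z s)) * (deriv ψ (z s) * (ψ (z s))⁻¹)‖ = ‖deriv ψ (z s)‖ := by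
        have : ‖ψ (z s)‖ ≠ 0 := norm_ne_zero_iff.2 (h0 _ (hz s hs))
        simp only [norm_mul, norm_inv, RCLike.norm_conj]
        field_simp
      rw [e1, ← e2]
      exact (abs_le.1 (abs_re_le_norm _)).1
    have h2 : normSq (ψ (z s)) * (-(ψ (z s)).im / normSq (ψ (z s))) = -(ψ (z s)).im := by
      field_simp
    rw [normSq_apply] at h2 ⊢
    set A := (ψ (z s)).re * (deriv ψ (z s) * (ψ (z s))⁻¹).re +
        (ψ (z s)).im * (deriv ψ (z s) * (ψ (z s))⁻¹).im with hA
    set D := -(ψ (z s)).im / ((ψ (z s)).re * (ψ (z s)).re + (ψ (z s)).im * (ψ (z s)).im)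
    have h3 : 0 ≤ 2 * (z s).im * ((z s).im * A + -(ψ (z s)).im) := by
      have : 0 ≤ (z s).im * (A + ‖deriv ψ (z s)‖) :=
        mul_nonneg hys.le (by linarith)
      exact mul_nonneg (by linarith) (by linarith)
    rw [← h2] at h3
    convert! h3 using 1
    simp only [Pi.mul_apply, Pi.add_apply]
    rw [hA]
    ring
  set c := ‖ψ (z 0)‖ * (z 0).im with hc
  have hc0 : 0 < c := mul_pos (norm_pos_iff.2 (h0 _ (hz 0 h0T))) (hpos 0 h0T)
  have hspeed : ∀ s ∈ Ico 0 T, c ≤ ‖ψ (z s)‖ * (z s).im := by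
    intro s hs
    have h1 := hN h0T hs hs.1
    simp only [N, ← normSq_apply, normSq_eq_norm_sq] at h1
    have h2 : c ^ 2 ≤ (‖ψ (z s)‖ * (z s).im) ^ 2 := by rw [hc, mul_pow, mul_pow]; nlinarith
    exact le_of_sq_le_sq h2 (mul_nonneg (norm_nonneg _) (hpos s hs).le)
  have hinv : ∀ s ∈ Ico 0 T, ‖(ψ (z s))⁻¹‖ ≤ (z s).im / c := by
    intro s hs
    have h1 : 0 < ‖ψ (z s)‖ := norm_pos_iff.2 (h0 _ (hz s hs))
    rw [norm_inv, inv_eq_one_div, div_le_div_iff₀ h1 hc0]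
    linarith [hspeed s hs]
  have hE : ∀ s : ℝ, HasDerivAt (fun s : ℝ => Real.exp (-s / c))
      (Real.exp (-s / c) * (-1 / c)) s := fun s =>
    ((hasDerivAt_neg s).div_const c).exp
  -- Grönwall's argument: `(Im z)' ≤ Im z / c`, so `Im z · exp(-s / c)` does not increase.
  have hanti : MonotoneOn (fun s => -((z s).im * Real.exp (-s / c))) (Ico 0 T) := by
    refine monotoneOn_Ico_of_hasDerivAt (fun s hs => ((hd s hs).complex_im.mul (hE s)).neg) ?_
    intro s hs
    have h1 : ((ψ (z s))⁻¹).im ≤ (z s).im / c :=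
      ((le_abs_self _).trans (abs_im_le_norm _)).trans (hinv s hs)
    have h2 : 0 ≤ Real.exp (-s / c) * ((z s).im / c - ((ψ (z s))⁻¹).im) :=
      mul_nonneg (Real.exp_pos _).le (by linarith)
    convert! h2 using 1
    ring
  have hupper : ∀ s ∈ Ico 0 T, (z s).im ≤ (z 0).im * Real.exp (T / c) := by
    intro s hs
    have h1 := hanti h0T hs hs.1
    simp only [neg_zero, zero_div, Real.exp_zero, mul_one, neg_le_neg_iff] at h1
    have h2 : (z s).im = (z s).im * Real.exp (-s / c) * Real.exp (s / c) := by
      rw [mul_assoc, ← Real.exp_add, neg_div, neg_add_cancel, Real.exp_zero, mul_one]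
    rw [h2]
    refine mul_le_mul h1 ?_ (Real.exp_pos _).le (hpos 0 h0T).le
    apply Real.exp_le_exp.2
    have := hs.2.le
    gcongr
  refine ⟨(z 0).im * Real.exp (T / c) / c * T, fun s hs => ⟨hmono s hs, ?_⟩⟩
  have hsub : Icc 0 s ⊆ Ico 0 T := fun t ht => ⟨ht.1, ht.2.trans_lt hs.2⟩
  have hM : 0 ≤ (z 0).im * Real.exp (T / c) / c :=
    div_nonneg (mul_nonneg (hpos 0 h0T).le (Real.exp_pos _).le) hc0.le
  have key := norm_image_sub_le_of_norm_deriv_le_segment'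
    (fun t ht => (hd t (hsub ht)).hasDerivWithinAt)
    (C := (z 0).im * Real.exp (T / c) / c)
    (fun t ht => (hinv t (hsub (Ico_subset_Icc_self ht))).trans
      (div_le_div_of_nonneg_right (hupper t (hsub (Ico_subset_Icc_self ht))) hc0.le))
    s ⟨hs.1, le_rfl⟩
  refine key.trans (mul_le_mul_of_nonneg_left ?_ hM)
  linarith [hs.2]

theorem IsNevanlinna.isStarlikeAtNegInfty_image {ψ Ψ : ℂ → ℂ} (h : IsNevanlinna ψ)
    (hne : ∃ z ∈ UpperHalfPlane.upperHalfPlaneSet, ψ z ≠ 0)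
    (hΨ : IsPrimitiveOnUpperHalf Ψ (fun z => -ψ z)) :
    IsStarlikeAtNegInfty (Ψ '' UpperHalfPlane.upperHalfPlaneSet) := by
  have hH := UpperHalfPlane.isOpen_upperHalfPlaneSet
  -- One rotation carries all values of `-ψ` into the right half-plane; this yields both injectivity
  -- of `Ψ` and absence of zeros of `ψ`.
  obtain ⟨u, hu⟩ : ∃ u : ℂ, ∀ z ∈ UpperHalfPlane.upperHalfPlaneSet, 0 < (u * -ψ z).re := by
    rcases h.eq_const_or_im_neg with ⟨c, hc⟩ | hneg
    · obtain ⟨w, hw, hw0⟩ := hne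
      rw [hc w hw] at hw0
      have hc0 : c ≠ 0 := by simpa using hw0
      refine ⟨-c, fun z hz => ?_⟩
      rw [hc z hz]
      have := mul_self_pos.2 hc0
      simpa
    · refine ⟨-I, fun z hz => ?_⟩
      have := hneg z hz
      simpa using this
  have h0 : ∀ z ∈ UpperHalfPlane.upperHalfPlaneSet, ψ z ≠ 0 := by
    intro z hz hz0
    have := hu z hz
    simp [hz0] at this
  have h0' : ∀ z ∈ UpperHalfPlane.upperHalfPlaneSet, -ψ z ≠ 0 := fun z hz => neg_ne_zero.2 (h0 z hz)
  have hinj : InjOn Ψ UpperHalfPlane.upperHalfPlaneSet :=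
    injOn_of_re_mul_deriv_pos convex_upperHalfPlaneSet hΨ hu
  have hopen : IsOpen (Ψ '' UpperHalfPlane.upperHalfPlaneSet) :=
    isOpen_image_of_deriv_ne_zero hH hΨ h0'
  refine ⟨hopen, isConnected_upperHalfPlaneSet.image Ψ
    (fun z hz => (hΨ z hz).continuousAt.continuousWithinAt),
    image_upperHalfPlaneSet_ne_univ hΨ h0' hinj, ?_⟩
  rintro t ht _ ⟨w, hw, rfl⟩
  by_contra hcon
  -- Times at which the leftward ray is outside the image. As the image is open, `B` is closed and
  -- the first exit time `T` belongs to it.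
  let B : Set ℝ := {s | 0 ≤ s ∧ w - s ∉ Ψ '' UpperHalfPlane.upperHalfPlaneSet}
  have hBc : IsClosed B := by
    refine isClosed_Ici.inter ?_
    exact (hopen.preimage (f := fun s : ℝ => w - (s : ℂ)) (by fun_prop)).isClosed_compl
  have hBb : BddBelow B := ⟨0, fun s hs => hs.1⟩
  obtain ⟨hT0, hTB⟩ : sInf B ∈ B := hBc.csInf_mem ⟨t, ht.le, hcon⟩ hBb
  set T := sInf B
  have hT : 0 < T := hT0.lt_of_ne fun h => hTB (by rw [← h]; simpa using hw)
  have hlt : ∀ s ∈ Ico 0 T, w - s ∈ Ψ '' UpperHalfPlane.upperHalfPlaneSet := by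
    intro s hs
    by_contra hs'
    exact absurd (csInf_le hBb ⟨hs.1, hs'⟩) (not_le.2 hs.2)
  -- Lift of the ray: differentiating `Ψ (z s) = w - s` gives `z' = 1 / ψ(z)`.
  let z : ℝ → ℂ := fun s => Function.invFunOn Ψ UpperHalfPlane.upperHalfPlaneSet (w - s)
  have hz : ∀ s ∈ Ico 0 T, z s ∈ UpperHalfPlane.upperHalfPlaneSet := fun s hs =>
    Function.invFunOn_mem (hlt s hs)
  have hΨz : ∀ s ∈ Ico 0 T, Ψ (z s) = w - s := fun s hs => Function.invFunOn_eq (hlt s hs)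
  have hd : ∀ s ∈ Ico 0 T, HasDerivAt z (ψ (z s))⁻¹ s := by
    intro s hs
    have h1 := hasDerivAt_invFunOn hH hΨ h0' hinj (hz s hs)
    rw [hΨz s hs] at h1
    have h2 : HasDerivAt (fun s : ℂ => w - s) (-1) (s : ℂ) := (hasDerivAt_id (s : ℂ)).const_sub w
    have h3 := (h1.comp (s : ℂ) h2).comp_ofReal
    convert! h3 using 1
    simp [inv_neg]
  obtain ⟨R, hR⟩ := h.exists_bound_of_hasDerivAt_inv h0 hT hz hd
  -- The lift stays in this compact set up to time `T`. So the closed set `Ψ '' K` contains the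
  -- limit `w - T`, contrary to the choice of `T`.
  let K : Set ℂ := closedBall (z 0) R ∩ {a | (z 0).im ≤ a.im}
  have hz0 : 0 < (z 0).im := hz 0 ⟨le_rfl, hT⟩
  have hKsub : K ⊆ UpperHalfPlane.upperHalfPlaneSet := fun a ha => hz0.trans_le ha.2
  have hKc : IsCompact K := (isCompact_closedBall _ _).inter_right
    (isClosed_le continuous_const continuous_im)
  have hΨK : IsClosed (Ψ '' K) := (hKc.image_of_continuousOn fun a ha =>
    (hΨ a (hKsub ha)).continuousAt.continuousWithinAt).isClosed
  have hlim : Tendsto (fun s : ℝ => w - (s : ℂ)) (𝓝[<] T) (𝓝 (w - (T : ℂ))) :=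
    (Continuous.tendsto (by fun_prop) T).mono_left nhdsWithin_le_nhds
  have hmem : w - (T : ℂ) ∈ Ψ '' K := by
    refine hΨK.mem_of_tendsto hlim ?_
    filter_upwards [Ico_mem_nhdsLT hT] with s hs
    refine ⟨z s, ⟨?_, (hR s hs).1⟩, hΨz s hs⟩
    rw [mem_closedBall, dist_eq_norm]
    exact (hR s hs).2
  exact hTB (image_mono hKsub hmem)

/-! ### Theorems of Montel and Hurwitz along filters -/

section NormalFamilies

variable {ι : Type*} {F : ι → ℂ → ℂ} {f : ℂ → ℂ} {φ : Filter ι} {U : Set ℂ}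

/-- A Lipschitz bound independent of `g`, hence equicontinuity of bounded families. The `2` is the
diameter of the unit disc. -/
lemma dist_le_of_ball_subset_of_norm_le_one {g : ℂ → ℂ} (hg : DifferentiableOn ℂ g U)
    (hb : ∀ z ∈ U, ‖g z‖ ≤ 1) {c w : ℂ} {r : ℝ} (hr : ball c r ⊆ U) (hw : w ∈ ball c r) :
    dist (g w) (g c) ≤ 2 / r * dist w c := by
  have hr0 : 0 < r := pos_of_mem_ball hw
  refine Complex.dist_le_div_mul_dist_of_mapsTo_ball (hg.mono hr) (fun z hz => ?_) hw
  rw [mem_closedBall]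
  calc dist (g z) (g c) ≤ ‖g z‖ + ‖g c‖ := dist_le_norm_add_norm _ _
    _ ≤ 2 := by linarith [hb z (hr hz), hb c (hr (mem_ball_self hr0))]

/-- Pointwise limits of uniformly bounded holomorphic functions are locally uniform
(**Vitali–Montel**). -/
theorem tendstoLocallyUniformlyOn_of_norm_le_one [φ.NeBot] (hU : IsOpen U)
    (hF : ∀ n, DifferentiableOn ℂ (F n) U) (hb : ∀ n, ∀ z ∈ U, ‖F n z‖ ≤ 1)
    (hlim : ∀ z ∈ U, Tendsto (fun n => F n z) φ (𝓝 (f z))) :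
    TendstoLocallyUniformlyOn F f φ U := by
  rw [Metric.tendstoLocallyUniformlyOn_iff]
  intro ε hε x hx
  obtain ⟨r, hr0, hr⟩ := Metric.isOpen_iff.1 hU x hx
  set δ := min r (ε * r / 8) with hδ
  have hδ0 : 0 < δ := lt_min hr0 (by positivity)
  have hsub : ball x δ ⊆ ball x r := ball_subset_ball (min_le_left _ _)
  have hbound : ∀ y ∈ ball x δ, 2 / r * dist y x ≤ ε / 4 := by
    intro y hy
    have h1 : dist y x ≤ ε * r / 8 := (mem_ball.1 hy).le.trans (min_le_right _ _)
    calc 2 / r * dist y x ≤ 2 / r * (ε * r / 8) := by gcongr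
      _ = ε / 4 := by field_simp; norm_num
  have hFe : ∀ n, ∀ y ∈ ball x δ, dist (F n y) (F n x) ≤ ε / 4 := fun n y hy =>
    (dist_le_of_ball_subset_of_norm_le_one (hF n) (hb n) hr (hsub hy)).trans (hbound y hy)
  have hfe : ∀ y ∈ ball x δ, dist (f y) (f x) ≤ ε / 4 := fun y hy =>
    le_of_tendsto ((hlim y (hr (hsub hy))).dist (hlim x hx))
      (Eventually.of_forall fun n => hFe n y hy)
  refine ⟨ball x δ, mem_nhdsWithin_of_mem_nhds (ball_mem_nhds x hδ0), ?_⟩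
  filter_upwards [Metric.tendsto_nhds.1 (hlim x hx) (ε / 4) (by positivity)] with n hn y hy
  have h1 := dist_triangle4 (f y) (f x) (F n x) (F n y)
  rw [dist_comm (f x), dist_comm (F n x) (F n y)] at h1
  linarith [hFe n y hy, hfe y hy]

/-- **Montel's theorem** for ultrafilters. -/
theorem exists_tendstoLocallyUniformlyOn_of_norm_le_one (φ : Ultrafilter ι) (hU : IsOpen U)
    (hF : ∀ n, DifferentiableOn ℂ (F n) U) (hb : ∀ n, ∀ z ∈ U, ‖F n z‖ ≤ 1) :
    ∃ f : ℂ → ℂ, TendstoLocallyUniformlyOn F f φ U ∧ ∀ z ∈ U, ‖f z‖ ≤ 1 := by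
  -- Compactness makes an ultrafilter converge at every point at once, so no diagonal subsequence is
  -- needed.
  have key : ∀ z ∈ U, ∃ l ∈ closedBall (0 : ℂ) 1, Tendsto (fun n => F n z) φ (𝓝 l) := by
    intro z hz
    refine (isCompact_closedBall (0 : ℂ) 1).ultrafilter_le_nhds (φ.map fun n => F n z) ?_
    rw [Ultrafilter.coe_map, le_principal_iff, mem_map]
    exact univ_mem' fun n => by simpa using hb n z hz
  choose! f hf using key
  exact ⟨f, tendstoLocallyUniformlyOn_of_norm_le_one hU hF hb fun z hz => (hf z hz).2,
    fun z hz => by simpa using (hf z hz).1⟩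

/-- **Hurwitz's theorem**: near an isolated zero of a locally uniform limit, the approximating
functions have zeros. -/
theorem eventually_exists_zero_of_tendstoLocallyUniformlyOn [φ.NeBot] (hU : IsOpen U)
    (hF : ∀ n, DifferentiableOn ℂ (F n) U) (hlim : TendstoLocallyUniformlyOn F f φ U) {z₀ : ℂ}
    (hz₀ : z₀ ∈ U) (h0 : f z₀ = 0) (hne : ¬ ∀ᶠ z in 𝓝 z₀, f z = 0) {V : Set ℂ}
    (hV : V ∈ 𝓝 z₀) : ∀ᶠ n in φ, ∃ z ∈ V, F n z = 0 := by
  have hfd : DifferentiableOn ℂ f U := hlim.differentiableOn (Eventually.of_forall hF) hU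
  have hiso := ((hfd.analyticAt (hU.mem_nhds hz₀)).eventually_eq_zero_or_eventually_ne_zero
    ).resolve_left hne
  rw [eventually_nhdsWithin_iff] at hiso
  obtain ⟨R, hR0, hR⟩ := Metric.mem_nhds_iff.1 (inter_mem (inter_mem hiso hV) (hU.mem_nhds hz₀))
  have hr0 : 0 < R / 2 := by positivity
  have hcb : closedBall z₀ (R / 2) ⊆ ball z₀ R := closedBall_subset_ball (by linarith)
  have hcbU : closedBall z₀ (R / 2) ⊆ U := fun z hz => (hR (hcb hz)).2
  have hsph : sphere z₀ (R / 2) ⊆ closedBall z₀ (R / 2) := sphere_subset_closedBall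
  obtain ⟨ζ, hζ, hζmin⟩ := (isCompact_sphere z₀ (R / 2)).exists_isMinOn
    (NormedSpace.sphere_nonempty.2 hr0.le) ((hfd.continuousOn.mono (hsph.trans hcbU)).norm)
  set ε := ‖f ζ‖ with hε
  have hε0 : 0 < ε := by
    refine norm_pos_iff.2 ((hR (hcb (hsph hζ))).1.1 ?_)
    rintro rfl
    simp at hζ
    linarith
  have hunif := (tendstoLocallyUniformlyOn_iff_forall_isCompact hU).1 hlim _ hcbU
    (isCompact_closedBall _ _)
  filter_upwards [Metric.tendstoUniformlyOn_iff.1 hunif (ε / 4) (by positivity)] with n hn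
  have hn0 : ‖F n z₀‖ < ε / 4 := by
    have := hn z₀ (mem_closedBall_self hr0.le)
    rwa [h0, dist_zero_left] at this
  -- With `ε = min |f|` on the circle, `ε - ε/4 - ε/4 = ε/2`. The quantitative open mapping theorem
  -- then puts the ball of radius `ε/4` about `F n z₀` in the image, and that ball contains `0`.
  have hlow : ∀ z ∈ sphere z₀ (R / 2), ε / 2 ≤ ‖F n z - F n z₀‖ := by
    intro z hz
    have h1 := hn z (hsph hz)
    rw [dist_eq_norm] at h1
    have h2 : ε ≤ ‖f z‖ := hζmin hz
    have h3 : ‖f z‖ ≤ ‖f z - F n z‖ + ‖F n z - F n z₀‖ + ‖F n z₀‖ := by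
      have := norm_add₃_le (a := f z - F n z) (b := F n z - F n z₀) (c := F n z₀)
      simpa using this
    linarith
  have hfreq : ∃ᶠ z in 𝓝 z₀, F n z ≠ F n z₀ := by
    intro hcon
    simp only [ne_eq, not_not] at hcon
    have han : AnalyticOnNhd ℂ (F n) (ball z₀ R) :=
      ((hF n).mono fun z hz => (hR hz).2).analyticOnNhd isOpen_ball
    have heq := han.eqOn_of_preconnected_of_eventuallyEq analyticOnNhd_const
      (convex_ball z₀ R).isPreconnected (mem_ball_self hR0) hcon
    have h1 := hlow ζ hζ
    rw [heq (hcb (hsph hζ)), sub_self, norm_zero] at h1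
    linarith
  have hsub := DiffContOnCl.ball_subset_image_closedBall
    (((hF n).mono hcbU).diffContOnCl_ball Subset.rfl) hr0 hlow hfreq
  obtain ⟨z, hz, hz0⟩ := hsub (show (0 : ℂ) ∈ ball (F n z₀) (ε / 2 / 2) by
    rw [mem_ball, dist_zero_left]; linarith)
  exact ⟨z, (hR (hcb hz)).1.2, hz0⟩

/-- **Hurwitz's theorem**: a locally uniform limit of zero-free holomorphic functions that is not
identically zero is zero-free. -/
theorem forall_ne_zero_of_tendstoLocallyUniformlyOn [φ.NeBot] (hU : IsOpen U)
    (hUc : IsPreconnected U) (hF : ∀ n, DifferentiableOn ℂ (F n) U)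
    (hlim : TendstoLocallyUniformlyOn F f φ U) (h0 : ∀ n, ∀ z ∈ U, F n z ≠ 0)
    (hne : ∃ z ∈ U, f z ≠ 0) : ∀ z ∈ U, f z ≠ 0 := by
  intro z hz hfz
  have hfd : DifferentiableOn ℂ f U := hlim.differentiableOn (Eventually.of_forall hF) hU
  obtain ⟨n, w, hw, hw0⟩ := (eventually_exists_zero_of_tendstoLocallyUniformlyOn hU hF hlim hz hfz
    (fun hcon => by
      obtain ⟨w, hw, hw0⟩ := hne
      exact hw0 ((hfd.analyticOnNhd hU).eqOn_zero_of_preconnected_of_eventuallyEq_zero hUc hz hcon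
        hw)) (hU.mem_nhds hz)).exists
  exact h0 n w hw hw0

/-- **Hurwitz's theorem**: a nonconstant locally uniform limit of injective holomorphic functions
is injective. -/
theorem injOn_of_tendstoLocallyUniformlyOn [φ.NeBot] (hU : IsOpen U)
    (hUc : IsPreconnected U) (hF : ∀ n, DifferentiableOn ℂ (F n) U)
    (hlim : TendstoLocallyUniformlyOn F f φ U) (hinj : ∀ n, InjOn (F n) U)
    (hne : ∃ z ∈ U, deriv f z ≠ 0) : InjOn f U := by
  intro a ha b hb hab
  by_contra hne'
  have hfd : DifferentiableOn ℂ f U := hlim.differentiableOn (Eventually.of_forall hF) hU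
  -- If `f a = f b`, Hurwitz's theorem at `b` gives `F n - F n a` a zero other than `a`, against
  -- injectivity.
  have hlim' : TendstoLocallyUniformlyOn (fun n z => F n z - F n a) (fun z => f z - f a) φ U := by
    rw [Metric.tendstoLocallyUniformlyOn_iff] at hlim ⊢
    intro ε hε x hx
    obtain ⟨t, ht, h⟩ := hlim (ε / 2) (by positivity) x hx
    obtain ⟨t', ht', h'⟩ := hlim (ε / 2) (by positivity) a ha
    refine ⟨t, ht, ?_⟩
    filter_upwards [h, h'] with n hn hn' y hy
    have := dist_sub_sub_le (f y) (f a) (F n y) (F n a)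
    linarith [hn y hy, hn' a (mem_of_mem_nhdsWithin ha ht')]
  have hF' : ∀ n, DifferentiableOn ℂ (fun z => F n z - F n a) U := fun n => (hF n).sub_const _
  obtain ⟨n, w, ⟨hwU, hwa⟩, hw0⟩ := (eventually_exists_zero_of_tendstoLocallyUniformlyOn hU hF' hlim'
    hb (by simp [hab]) (fun hcon => by
      obtain ⟨w, hw, hw0⟩ := hne
      have hz := ((hfd.sub_const (f a)).analyticOnNhd
        hU).eqOn_zero_of_preconnected_of_eventuallyEq_zero hUc hb hcon
      have heq : f =ᶠ[𝓝 w] fun _ => f a := by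
        filter_upwards [hU.mem_nhds hw] with y hy
        exact sub_eq_zero.1 (hz hy)
      rw [heq.deriv_eq, deriv_const] at hw0
      exact hw0 rfl) (inter_mem (hU.mem_nhds hb) (isOpen_ne.mem_nhds (Ne.symm hne')))).exists
  exact hwa (hinj n hwU ha (sub_eq_zero.1 hw0))

end NormalFamilies

/-! ### The Riemann mapping theorem -/

/-- `f` maps `U` holomorphically and injectively into the unit disc. -/
structure IsDiscEmbedding (f : ℂ → ℂ) (U : Set ℂ) : Prop where
  differentiableOn : DifferentiableOn ℂ f U
  norm_lt_one : ∀ z ∈ U, ‖f z‖ < 1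
  injOn : InjOn f U
  deriv_ne_zero : ∀ z ∈ U, deriv f z ≠ 0

namespace IsDiscEmbedding

variable {f : ℂ → ℂ} {U : Set ℂ}

lemma hasDerivAt (hf : IsDiscEmbedding f U) (hU : IsOpen U) {z : ℂ} (hz : z ∈ U) :
    HasDerivAt f (deriv f z) z :=
  (hf.differentiableOn.differentiableAt (hU.mem_nhds hz)).hasDerivAt

lemma hasDerivAt_discAut_comp (hf : IsDiscEmbedding f U) (hU : IsOpen U) {a z : ℂ} (ha : ‖a‖ < 1)
    (hz : z ∈ U) : HasDerivAt (fun z => discAut a (f z))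
      ((1 - conj a * a) / (1 - conj a * f z) ^ 2 * deriv f z) z :=
  (hasDerivAt_discAut ha (hf.norm_lt_one z hz)).comp z (hf.hasDerivAt hU hz)

lemma discAut_comp (hf : IsDiscEmbedding f U) (hU : IsOpen U) {a : ℂ} (ha : ‖a‖ < 1) :
    IsDiscEmbedding (fun z => discAut a (f z)) U where
  differentiableOn := fun _ hz =>
    (hf.hasDerivAt_discAut_comp hU ha hz).differentiableAt.differentiableWithinAt
  norm_lt_one := fun z hz => norm_discAut_lt_one ha (hf.norm_lt_one z hz)
  injOn := fun z hz w hw h => hf.injOn hz hw <| discAut_injOn ha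
    (by simpa using hf.norm_lt_one z hz) (by simpa using hf.norm_lt_one w hw) h
  deriv_ne_zero := fun z hz => by
    rw [(hf.hasDerivAt_discAut_comp hU ha hz).deriv]
    exact mul_ne_zero (div_ne_zero (one_sub_conj_mul_self_ne_zero ha)
      (pow_ne_zero 2 (one_sub_conj_mul_ne_zero ha (hf.norm_lt_one z hz)))) (hf.deriv_ne_zero z hz)

end IsDiscEmbedding

/-- The difference quotient of `k` is that of `g = k²` divided by `k w + k z`, which tends to `2 k z
≠ 0`; continuity of the root suffices. -/
lemma hasDerivAt_of_sq_eq {k g : ℂ → ℂ} {g' z : ℂ} (hk : ContinuousAt k z) (hkz : k z ≠ 0)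
    (hsq : ∀ w, k w ^ 2 = g w) (hg : HasDerivAt g g' z) : HasDerivAt k (g' / (2 * k z)) z := by
  rw [hasDerivAt_iff_tendsto_slope] at hg ⊢
  have hsum : Tendsto (fun w => k w + k z) (𝓝[≠] z) (𝓝 (2 * k z)) := by
    rw [two_mul]
    exact (hk.tendsto.mono_left nhdsWithin_le_nhds).add_const _
  have h2 : 2 * k z ≠ 0 := mul_ne_zero two_ne_zero hkz
  refine (hg.div hsum h2).congr' ?_
  filter_upwards [hsum.eventually_ne h2] with w hw
  rw [Pi.div_apply, slope_def_field, slope_def_field, ← hsq, ← hsq]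
  rw [show k w ^ 2 - k z ^ 2 = (k w - k z) * (k w + k z) by ring, mul_div_right_comm,
    mul_div_cancel_right₀ _ hw]

/-- The square root trick in the proof of the Riemann mapping theorem. -/
lemma IsDiscEmbedding.exists_norm_deriv_lt {f : ℂ → ℂ} {U : Set ℂ} (hf : IsDiscEmbedding f U)
    (hU : IsOpen U) (hUc : IsSimplyConnected U) {w₀ : ℂ} (hw₀ : w₀ ∈ U) (hf0 : f w₀ = 0) {a : ℂ}
    (ha : ‖a‖ < 1) (haU : a ∉ f '' U) :
    ∃ g, IsDiscEmbedding g U ∧ g w₀ = 0 ∧ ‖deriv f w₀‖ < ‖deriv g w₀‖ := by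
  -- Moving the omitted value `a` to `0` makes `g` zero-free, so it has a square root on the simply
  -- connected `U`.
  set g := fun z => discAut a (f z) with hgdef
  have hg : IsDiscEmbedding g U := hf.discAut_comp hU ha
  have hg0 : ∀ z ∈ U, g z ≠ 0 := by
    intro z hz h0
    refine haU ⟨z, hz, discAut_injOn ha (by simpa using hf.norm_lt_one z hz) (by simpa using ha) ?_⟩
    rw [discAut_self]
    exact h0
  obtain ⟨k, hkc, hk⟩ := Complex.exists_continuousOn_pow_eq hUc hU hg.differentiableOn.continuousOn
    (by rintro ⟨z, hz, h⟩; exact hg0 z hz h) two_ne_zero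
  have hk0 : ∀ z ∈ U, k z ≠ 0 := fun z hz h => hg0 z hz (by rw [← hk, h]; simp)
  have hkd : ∀ z ∈ U, HasDerivAt k (deriv g z / (2 * k z)) z := fun z hz =>
    hasDerivAt_of_sq_eq (hkc.continuousAt (hU.mem_nhds hz)) (hk0 z hz) hk (hg.hasDerivAt hU hz)
  have hkE : IsDiscEmbedding k U :=
    { differentiableOn := fun z hz => (hkd z hz).differentiableAt.differentiableWithinAt
      norm_lt_one := fun z hz => by
        have := hg.norm_lt_one z hz
        rwa [← hk, norm_pow, sq_lt_one_iff₀ (norm_nonneg _)] at this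
      injOn := fun z hz w hw h => hg.injOn hz hw (by rw [← hk, ← hk, h])
      deriv_ne_zero := fun z hz => by
        rw [(hkd z hz).deriv]
        exact div_ne_zero (hg.deriv_ne_zero z hz) (mul_ne_zero two_ne_zero (hk0 z hz)) }
  have hb := hkE.norm_lt_one w₀ hw₀
  refine ⟨_, hkE.discAut_comp hU hb, discAut_self _, ?_⟩
  rw [(hkE.hasDerivAt_discAut_comp hU hb hw₀).deriv, (hkd w₀ hw₀).deriv,
    (hf.hasDerivAt_discAut_comp hU ha hw₀).deriv, hf0]
  set β := ‖k w₀‖ with hβ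
  have hβ0 : 0 < β := norm_pos_iff.2 (hk0 w₀ hw₀)
  have haβ : ‖a‖ = β ^ 2 := by
    rw [hβ, ← norm_pow, hk]
    simp [g, hf0, discAut]
  have hn : ∀ c : ℂ, ‖c‖ < 1 → ‖1 - conj c * c‖ = 1 - ‖c‖ ^ 2 := by
    intro c hc
    rw [conj_mul', ← ofReal_pow, ← ofReal_one, ← ofReal_sub, norm_real, Real.norm_of_nonneg]
    nlinarith [norm_nonneg c]
  have hD : 0 < ‖deriv f w₀‖ := norm_pos_iff.2 (hf.deriv_ne_zero w₀ hw₀)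
  simp only [norm_mul, norm_div, norm_pow, hn _ hb, hn _ ha, mul_zero, sub_zero,
    one_pow, div_one, Complex.norm_ofNat]
  rw [haβ, ← hβ]
  have h1 : 0 < 1 - β ^ 2 := by nlinarith
  -- With `β = √|a| < 1` the derivative grows by `(1 + β²) / (2β)`, which exceeds `1` because `(1 -
  -- β)² > 0`.
  have h2 : (1 - β ^ 2) / (1 - β ^ 2) ^ 2 * ((1 - (β ^ 2) ^ 2) * ‖deriv f w₀‖ / (2 * β)) =
      ‖deriv f w₀‖ * ((1 + β ^ 2) / (2 * β)) := by
    field_simp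
    ring
  rw [h2]
  refine lt_mul_of_one_lt_right hD ?_
  rw [one_lt_div (by positivity)]
  nlinarith [sq_pos_of_pos (sub_pos.2 hb)]

/-- The **Riemann mapping theorem** for simply connected domains that embed in the unit disc. -/
theorem IsDiscEmbedding.exists_image_eq_ball {f₀ : ℂ → ℂ} {U : Set ℂ} (hf₀ : IsDiscEmbedding f₀ U)
    (hU : IsOpen U) (hUc : IsSimplyConnected U) : ∃ f, IsDiscEmbedding f U ∧ f '' U = ball 0 1 := by
  obtain ⟨w₀, hw₀⟩ := hUc.nonempty
  have hUp : IsPreconnected U := hUc.isPathConnected.isConnected.isPreconnected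
  -- Extremal problem: maximize `|f' w₀|` among embeddings with `f w₀ = 0`. A limit of a maximizing
  -- sequence is an embedding, and the square root trick shows that it omits no value of the disc.
  let S : Set ℝ := {x | ∃ f, IsDiscEmbedding f U ∧ f w₀ = 0 ∧ ‖deriv f w₀‖ = x}
  have hS0 : ‖deriv (fun z => discAut (f₀ w₀) (f₀ z)) w₀‖ ∈ S :=
    ⟨_, hf₀.discAut_comp hU (hf₀.norm_lt_one _ hw₀), discAut_self _, rfl⟩
  have hSb : BddAbove S := by
    obtain ⟨r, hr0, hr⟩ := Metric.isOpen_iff.1 hU w₀ hw₀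
    refine ⟨1 / r, ?_⟩
    rintro _ ⟨f, hf, hf0, rfl⟩
    refine Complex.norm_deriv_le_div_of_mapsTo_ball (hf.differentiableOn.mono hr) ?_ hr0
    intro z hz
    rw [hf0, mem_closedBall_zero_iff]
    exact (hf.norm_lt_one z (hr hz)).le
  obtain ⟨u, -, hu, huS⟩ := exists_seq_tendsto_sSup ⟨_, hS0⟩ hSb
  set M := sSup S
  have hM : 0 < M := (norm_pos_iff.2 ((hf₀.discAut_comp hU (hf₀.norm_lt_one _ hw₀)).deriv_ne_zero
    w₀ hw₀)).trans_le (le_csSup hSb hS0)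
  choose F hF hF0 hFd using huS
  have hFdiff : ∀ n, DifferentiableOn ℂ (F n) U := fun n => (hF n).differentiableOn
  obtain ⟨f, hlim, hfb⟩ := exists_tendstoLocallyUniformlyOn_of_norm_le_one (hyperfilter ℕ) hU
    hFdiff (fun n z hz => ((hF n).norm_lt_one z hz).le)
  have hfd : DifferentiableOn ℂ f U := hlim.differentiableOn (Eventually.of_forall hFdiff) hU
  have hlim' := hlim.deriv (Eventually.of_forall hFdiff) hU
  have hle : (hyperfilter ℕ : Filter ℕ) ≤ atTop := by
    rw [← Nat.cofinite_eq_atTop]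
    exact hyperfilter_le_cofinite
  have hfM : ‖deriv f w₀‖ = M := by
    refine tendsto_nhds_unique (hlim'.tendsto_at hw₀).norm ?_
    simp only [Function.comp_apply, hFd]
    exact hu.mono_left hle
  have hfne : deriv f w₀ ≠ 0 := norm_pos_iff.1 (hfM ▸ hM)
  have hf0 : f w₀ = 0 := by
    refine tendsto_nhds_unique (hlim.tendsto_at hw₀) ?_
    simp only [hF0]
    exact tendsto_const_nhds
  have hdne : ∀ z ∈ U, deriv f z ≠ 0 :=
    forall_ne_zero_of_tendstoLocallyUniformlyOn hU hUp (fun n => (hFdiff n).deriv hU) hlim'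
      (fun n => (hF n).deriv_ne_zero) ⟨w₀, hw₀, hfne⟩
  have hfder : ∀ z ∈ U, HasDerivAt f (deriv f z) z := fun z hz =>
    (hfd.differentiableAt (hU.mem_nhds hz)).hasDerivAt
  have hfE : IsDiscEmbedding f U :=
    { differentiableOn := hfd
      norm_lt_one := fun z hz => by
        have h1 : f '' U ⊆ interior (closedBall 0 1) :=
          interior_maximal (by rintro _ ⟨z, hz, rfl⟩; simpa using hfb z hz)
            (isOpen_image_of_deriv_ne_zero hU hfder hdne)
        rw [interior_closedBall _ one_ne_zero] at h1
        simpa using h1 (mem_image_of_mem f hz)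
      injOn := injOn_of_tendstoLocallyUniformlyOn hU hUp hFdiff hlim (fun n => (hF n).injOn)
        ⟨w₀, hw₀, hfne⟩
      deriv_ne_zero := hdne }
  refine ⟨f, hfE, Subset.antisymm ?_ ?_⟩
  · rintro _ ⟨z, hz, rfl⟩
    simpa using hfE.norm_lt_one z hz
  · intro a ha
    by_contra haU
    obtain ⟨g, hg, hg0, hgd⟩ :=
      hfE.exists_norm_deriv_lt hU hUc hw₀ hf0 (by simpa using ha) haU
    have := le_csSup hSb ⟨g, hg, hg0, rfl⟩
    linarith

/-! ### Conformal type of domains starlike at `-∞` -/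

lemma IsStarlikeAtNegInfty.sub_mem {Ω : Set ℂ} (h : IsStarlikeAtNegInfty Ω) {w : ℂ} (hw : w ∈ Ω)
    {t : ℝ} (ht : 0 ≤ t) : w - t ∈ Ω := by
  rcases ht.eq_or_lt with rfl | ht
  · simpa using hw
  · exact h.sub_subset t ht (mem_image_of_mem _ hw)

/-- A domain starlike at `-∞` is homotopy equivalent to its projection to the imaginary axis. -/
theorem IsStarlikeAtNegInfty.isSimplyConnected {Ω : Set ℂ} (h : IsStarlikeAtNegInfty Ω) :
    IsSimplyConnected Ω := by
  set J : Set ℝ := im '' Ω with hJ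
  have hJc : Convex ℝ J :=
    (h.isConnected.isPreconnected.image im continuous_im.continuousOn).ordConnected.convex
  have hJne : J.Nonempty := h.isConnected.nonempty.image im
  have := hJc.contractibleSpace hJne
  let t : J → Set ℝ := fun y => {r | (r : ℂ) + (y : ℝ) * I ∈ Ω}
  have ht : ∀ y, Convex ℝ (t y) := by
    intro y
    refine OrdConnected.convex ⟨fun r _ s hs q hq => ?_⟩
    have h1 := h.sub_mem hs (sub_nonneg.2 hq.2)
    have h2 : ((s : ℂ) + (y : ℝ) * I) - ((s - q : ℝ) : ℂ) = q + (y : ℝ) * I := by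
      push_cast; ring
    rw [h2] at h1
    exact h1
  have hloc : ∀ y : J, ∃ c : ℝ, ∀ᶠ y' in 𝓝 y, c ∈ t y' := by
    rintro ⟨_, w, hw, rfl⟩
    refine ⟨w.re, ?_⟩
    have hc : Continuous fun y' : J => (w.re : ℂ) + ((y' : ℝ) : ℂ) * I := by fun_prop
    exact (h.isOpen.preimage hc).mem_nhds (by simpa [re_add_im] using hw)
  -- The slices `t y` are intervals, and a real part admissible at `y` remains so nearby; hence a
  -- continuous section exists. Horizontal segments then retract `Ω` onto its graph.
  obtain ⟨v, hv⟩ := exists_continuous_forall_mem_convex_of_local_const ht hloc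
  let p : C(Ω, J) := ⟨fun w => ⟨(w : ℂ).im, mem_image_of_mem im w.2⟩, by fun_prop⟩
  let q : C(J, Ω) := ⟨fun y => ⟨(v y : ℂ) + (y : ℝ) * I, hv y⟩, by fun_prop⟩
  have hmem : ∀ x : unitInterval × Ω,
      (((1 - x.1) * v (p x.2) + x.1 * (x.2 : ℂ).re : ℝ) : ℂ) + ((x.2 : ℂ).im : ℂ) * I ∈ Ω := by
    rintro ⟨s, w⟩
    refine ht (p w) (hv (p w)) ?_ (sub_nonneg.2 s.2.2) s.2.1 (sub_add_cancel _ _)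
    change ((w : ℂ).re : ℂ) + ((w : ℂ).im : ℂ) * I ∈ Ω
    rw [re_add_im]
    exact w.2
  have hleft : (q.comp p).Homotopic (ContinuousMap.id Ω) :=
    ⟨{ toFun := fun x => ⟨_, hmem x⟩
       continuous_toFun := by fun_prop
       map_zero_left := fun w => by
        apply Subtype.ext
        simp [p, q]
       map_one_left := fun w => by
        apply Subtype.ext
        simp [re_add_im] }⟩
  have hright : (p.comp q).Homotopic (ContinuousMap.id J) := by
    have : p.comp q = ContinuousMap.id J := by
      ext y
      simp [p, q]
    rw [this]
  have hΩ : ContractibleSpace Ω :=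
    ContinuousMap.HomotopyEquiv.contractibleSpace (Y := J) ⟨p, q, hleft, hright⟩
  exact SimplyConnectedSpace.ofContractible Ω

/-- A domain starlike at `-∞` omits a horizontal ray, so a branch of the square root embeds it in a
half-plane. -/
theorem IsStarlikeAtNegInfty.exists_isDiscEmbedding {Ω : Set ℂ} (h : IsStarlikeAtNegInfty Ω) :
    ∃ f, IsDiscEmbedding f Ω := by
  obtain ⟨a, ha⟩ := (ne_univ_iff_exists_notMem Ω).1 h.ne_univ
  -- With `a`, the whole ray `a + [0, ∞)` is omitted: translating one of its points left would reach
  -- `a`.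
  have hslit : ∀ w ∈ Ω, a - w ∈ slitPlane := by
    intro w hw
    by_contra hcon
    rw [mem_slitPlane_iff, not_or, not_lt, not_not] at hcon
    apply ha
    have h1 := h.sub_mem hw (t := -(a - w).re) (by linarith [hcon.1])
    convert h1 using 1
    apply Complex.ext
    · simp
    · have := hcon.2
      simp at this ⊢
      linarith
  let r : ℂ → ℂ := fun w => exp (log (a - w) / 2)
  have hr2 : ∀ w ∈ Ω, r w ^ 2 = a - w := by
    intro w hw
    rw [← exp_nat_mul]
    push_cast
    rw [mul_div_cancel₀ _ two_ne_zero, exp_log (slitPlane_ne_zero (hslit w hw))]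
  have hre : ∀ w ∈ Ω, 0 < (r w).re := by
    intro w hw
    have h1 := neg_pi_lt_arg (a - w)
    have h2 := (arg_le_pi (a - w)).lt_of_ne (mem_slitPlane_iff_arg.1 (hslit w hw)).1
    have h3 : (log (a - w) / 2).im = arg (a - w) / 2 := by
      rw [show (2 : ℂ) = ((2 : ℝ) : ℂ) by simp, div_ofReal_im, log_im]
    simp only [r, exp_re, h3]
    exact mul_pos (Real.exp_pos _) (Real.cos_pos_of_mem_Ioo ⟨by linarith, by linarith⟩)
  have hr1 : ∀ w ∈ Ω, r w + 1 ≠ 0 := by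
    intro w hw h0
    have h1 := congrArg re h0
    have h2 := hre w hw
    simp at h1
    linarith
  have hrd : ∀ w ∈ Ω, HasDerivAt r (r w * (-1 / (a - w) / 2)) w := by
    intro w hw
    exact ((((hasDerivAt_id w).const_sub a).clog (hslit w hw)).div_const 2).cexp
  -- `(r - 1) / (r + 1)` carries the right half-plane into the disc.
  have hfd : ∀ w ∈ Ω, HasDerivAt (fun w => (r w - 1) / (r w + 1))
      (2 * (r w * (-1 / (a - w) / 2)) / (r w + 1) ^ 2) w := by
    intro w hw
    convert! ((hrd w hw).sub_const 1).div ((hrd w hw).add_const 1) (hr1 w hw) using 1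
    ring
  refine ⟨fun w => (r w - 1) / (r w + 1), ⟨fun w hw =>
    (hfd w hw).differentiableAt.differentiableWithinAt, fun w hw => ?_, fun w hw w' hw' heq => ?_,
    fun w hw => ?_⟩⟩
  · rw [← normSq_lt_one_iff, normSq_div, div_lt_one (normSq_pos.2 (hr1 w hw))]
    have := hre w hw
    simp [normSq_apply]
    nlinarith
  · have h1 : (r w - 1) / (r w + 1) = (r w' - 1) / (r w' + 1) := heq
    rw [div_eq_div_iff (hr1 w hw) (hr1 w' hw')] at h1
    have h2 : r w = r w' := by linear_combination h1 / 2
    have h3 := hr2 w hw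
    rw [h2, hr2 w' hw'] at h3
    linear_combination h3
  · rw [(hfd w hw).deriv]
    have := slitPlane_ne_zero (hslit w hw)
    have h1 : r w ≠ 0 := exp_ne_zero _
    have h2 := hr1 w hw
    exact div_ne_zero (mul_ne_zero two_ne_zero (mul_ne_zero h1 (div_ne_zero
      (div_ne_zero (neg_ne_zero.2 one_ne_zero) this) two_ne_zero))) (pow_ne_zero 2 h2)

theorem IsStarlikeAtNegInfty.exists_riemann_map {Ω : Set ℂ} (h : IsStarlikeAtNegInfty Ω) :
    ∃ G, IsDiscEmbedding G Ω ∧ G '' Ω = ball 0 1 := by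
  obtain ⟨f, hf⟩ := h.exists_isDiscEmbedding
  exact hf.exists_image_eq_ball h.isOpen h.isSimplyConnected

/-! ### Horodiscs and the Wolff point -/

/-- The Poisson kernel of the unit disc with pole at `τ`; its superlevel sets are horodiscs. -/
noncomputable def horo (τ z : ℂ) : ℝ := (1 - normSq z) / normSq (1 - conj τ * z)

lemma one_sub_conj_mul_ne_zero_of_norm_eq_one {τ z : ℂ} (hτ : ‖τ‖ = 1) (hz : ‖z‖ < 1) :
    1 - conj τ * z ≠ 0 := by
  intro h
  have h2 : ‖τ‖ * ‖z‖ = 1 := by simpa using congrArg norm (sub_eq_zero.mp h).symm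
  rw [hτ, one_mul] at h2
  linarith

/-- A form of the **Schwarz–Pick lemma**. -/
lemma horo_mul_le_horo_mul {h : ℂ → ℂ} (hd : DifferentiableOn ℂ h (ball 0 1))
    (hm : MapsTo h (ball 0 1) (ball 0 1)) {a z : ℂ} (ha : ‖a‖ < 1) (hz : ‖z‖ < 1) :
    (1 - normSq a) * horo a z ≤ (1 - normSq (h a)) * horo (h a) (h z) := by
  have hm' : ∀ w : ℂ, ‖w‖ < 1 → ‖h w‖ < 1 := fun w hw => by simpa using hm (by simpa using hw)
  have h1 := norm_discAut_map_le hd hm ha hz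
  have h2 : normSq (discAut (h a) (h z)) ≤ normSq (discAut a z) := by
    rw [normSq_eq_norm_sq, normSq_eq_norm_sq]
    gcongr
  have h3 := one_sub_normSq_discAut ha hz
  have h4 := one_sub_normSq_discAut (hm' a ha) (hm' z hz)
  -- For `a` inside the disc, `(1 - |a|²) · horo a z` equals `1 - |discAut a z|²`.
  rw [horo, horo, ← mul_div_assoc, ← mul_div_assoc, ← h3, ← h4]
  linarith

/-- Otherwise the sequence would eventually increase and stay above a positive term. It selects the
orbit points at which Wolff's inequality passes to the limit. -/
lemma exists_frequently_succ_le_of_tendsto_zero {p : ℕ → ℝ} (hp : ∀ n, 0 < p n)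
    (hlim : Tendsto p atTop (𝓝 0)) : ∃ᶠ n in atTop, p (n + 1) ≤ p n := by
  intro hcon
  simp only [not_le] at hcon
  obtain ⟨N, hN⟩ := eventually_atTop.1 hcon
  have hmono : ∀ n, N ≤ n → p N ≤ p n := by
    intro n hn
    induction n, hn using Nat.le_induction with
    | base => exact le_rfl
    | succ n hn ih => exact ih.trans (hN n hn).le
  exact (hp N).not_ge (ge_of_tendsto hlim (eventually_atTop.2 ⟨N, hmono⟩))

section WolffPoint

variable {Ω : Set ℂ} {G : ℂ → ℂ}

/-- The semigroup of holomorphic self-maps of the disc conjugate to the translations of `Ω`. -/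
lemma IsStarlikeAtNegInfty.conj_translation (h : IsStarlikeAtNegInfty Ω) (hG : IsDiscEmbedding G Ω)
    (hGΩ : G '' Ω = ball 0 1) {t : ℝ} (ht : 0 ≤ t) :
    ∃ k : ℂ → ℂ, DifferentiableOn ℂ k (ball 0 1) ∧ MapsTo k (ball 0 1) (ball 0 1) ∧
      ∀ w ∈ Ω, k (G w) = G (w - t) := by
  have hk : ∀ w ∈ Ω, G (Function.invFunOn G Ω (G w) - t) = G (w - t) := fun w hw => by
    rw [hG.injOn.leftInvOn_invFunOn hw]
  refine ⟨fun z => G (Function.invFunOn G Ω z - t), ?_, ?_, hk⟩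
  · rw [← hGΩ]
    rintro _ ⟨w, hw, rfl⟩
    refine DifferentiableAt.differentiableWithinAt ?_
    have h1 := hasDerivAt_invFunOn h.isOpen (fun z hz => hG.hasDerivAt h.isOpen hz)
      hG.deriv_ne_zero hG.injOn hw
    have h2 := hG.hasDerivAt h.isOpen (h.sub_mem hw ht)
    refine DifferentiableAt.comp (g := G) (G w) ?_ (h1.differentiableAt.sub_const _)
    rw [hG.injOn.leftInvOn_invFunOn hw]
    exact h2.differentiableAt
  · rw [← hGΩ]
    rintro _ ⟨w, hw, rfl⟩
    simp only [hk w hw]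
    exact mem_image_of_mem G (h.sub_mem hw ht)

/-- A compact subset of the disc has bounded preimage under `G`, while `w - n t` tends to infinity.
This plays the role of having no fixed point. -/
lemma IsStarlikeAtNegInfty.tendsto_one_sub_normSq (h : IsStarlikeAtNegInfty Ω)
    (hG : IsDiscEmbedding G Ω) (hGΩ : G '' Ω = ball 0 1) {t : ℝ} (ht : 0 < t) {w : ℂ} (hw : w ∈ Ω) :
    Tendsto (fun n : ℕ => 1 - normSq (G (w - (n * t : ℝ)))) atTop (𝓝 0) := by
  have hmem : ∀ n : ℕ, w - (n * t : ℝ) ∈ Ω := fun n => h.sub_mem hw (by positivity)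
  have hlt : ∀ n : ℕ, normSq (G (w - (n * t : ℝ))) < 1 := fun n =>
    normSq_lt_one_iff.2 (hG.norm_lt_one _ (hmem n))
  rw [Metric.tendsto_atTop]
  intro ε hε
  by_contra! hcon
  let K : Set ℂ := {z | normSq z ≤ 1 - ε}
  have hKsub : K ⊆ ball 0 1 := by
    intro z hz
    rw [mem_ball_zero_iff, ← normSq_lt_one_iff]
    exact lt_of_le_of_lt hz (by linarith)
  have hKc : IsCompact K := Metric.isCompact_of_isClosed_isBounded
    (isClosed_le continuous_normSq continuous_const) (Metric.isBounded_ball.subset hKsub)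
  have hcont : ContinuousOn (Function.invFunOn G Ω) K := by
    intro z hz
    obtain ⟨w, hw, rfl⟩ := hGΩ.symm.subset (hKsub hz)
    exact (hasDerivAt_invFunOn h.isOpen (fun z hz => hG.hasDerivAt h.isOpen hz)
      hG.deriv_ne_zero hG.injOn hw).continuousAt.continuousWithinAt
  obtain ⟨R, hR⟩ := (hKc.image_of_continuousOn hcont).isBounded.exists_norm_le
  obtain ⟨N, hN⟩ := exists_nat_gt ((R + ‖w‖) / t)
  obtain ⟨n, hn, hnε⟩ := hcon N
  rw [Real.dist_eq, sub_zero, abs_of_pos (by linarith [hlt n])] at hnε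
  have h1 := hR (w - (n * t : ℝ)) ⟨G (w - (n * t : ℝ)),
    show normSq (G (w - (n * t : ℝ))) ≤ 1 - ε by linarith,
    hG.injOn.leftInvOn_invFunOn (hmem n)⟩
  have h2 : (n * t : ℝ) ≤ ‖w - (n * t : ℝ)‖ + ‖w‖ := by
    have h3 := norm_sub_le w (w - (n * t : ℝ))
    rw [sub_sub_cancel, norm_real, Real.norm_of_nonneg (by positivity)] at h3
    linarith
  rw [div_lt_iff₀ ht] at hN
  have h4 : (N : ℝ) * t ≤ n * t := by gcongr
  linarith

/-- Wolff's argument: apply Schwarz–Pick with centre at the orbit points `a n = G (w₀ - n t)`, along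
indices where `1 - |a n|²` does not grow, and let `a n → τ`. -/
lemma IsStarlikeAtNegInfty.exists_horo_le (h : IsStarlikeAtNegInfty Ω)
    (hG : IsDiscEmbedding G Ω) (hGΩ : G '' Ω = ball 0 1) {t : ℝ} (ht : 0 < t) :
    ∃ τ : ℂ, ‖τ‖ = 1 ∧ ∀ w ∈ Ω, horo τ (G w) ≤ horo τ (G (w - t)) := by
  obtain ⟨w₀, hw₀⟩ := h.isConnected.nonempty
  obtain ⟨k, hkd, hkm, hk⟩ := h.conj_translation hG hGΩ ht.le
  let b : ℕ → ℂ := fun n => w₀ - (n * t : ℝ)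
  have hb : ∀ n, b n ∈ Ω := fun n => h.sub_mem hw₀ (by positivity)
  have hbs : ∀ n, b n - t = b (n + 1) := fun n => by simp only [b]; push_cast; ring
  let a : ℕ → ℂ := fun n => G (b n)
  have ha : ∀ n, ‖a n‖ < 1 := fun n => hG.norm_lt_one _ (hb n)
  have hka : ∀ n, k (a n) = a (n + 1) := fun n => by rw [hk _ (hb n), hbs]
  let p : ℕ → ℝ := fun n => 1 - normSq (a n)
  have hp : ∀ n, 0 < p n := fun n => sub_pos.2 (normSq_lt_one_iff.2 (ha n))
  have hplim : Tendsto p atTop (𝓝 0) := h.tendsto_one_sub_normSq hG hGΩ ht hw₀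
  have hfreq := exists_frequently_succ_le_of_tendsto_zero hp hplim
  have : (atTop ⊓ 𝓟 {n | p (n + 1) ≤ p n}).NeBot := by
    rwa [← frequently_iff_neBot]
  let φ : Ultrafilter ℕ := Ultrafilter.of (atTop ⊓ 𝓟 {n | p (n + 1) ≤ p n})
  have hφ : (φ : Filter ℕ) ≤ atTop ⊓ 𝓟 {n | p (n + 1) ≤ p n} := Ultrafilter.of_le _
  have hφ1 : (φ : Filter ℕ) ≤ atTop := hφ.trans inf_le_left
  have hφ2 : ∀ᶠ n in (φ : Filter ℕ), p (n + 1) ≤ p n := le_principal_iff.1 (hφ.trans inf_le_right)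
  have hlim : ∀ c : ℕ → ℂ, (∀ n, ‖c n‖ < 1) → ∃ l, Tendsto c φ (𝓝 l) := by
    intro c hc
    obtain ⟨l, -, hl⟩ := (isCompact_closedBall (0 : ℂ) 1).ultrafilter_le_nhds (φ.map c) (by
      rw [Ultrafilter.coe_map, le_principal_iff, mem_map]
      exact univ_mem' fun n => by simpa using (hc n).le)
    exact ⟨l, hl⟩
  obtain ⟨τ, hτ⟩ := hlim a ha
  obtain ⟨τ', hτ'⟩ := hlim (fun n => a (n + 1)) fun n => ha _
  have hp0 : Tendsto p φ (𝓝 0) := hplim.mono_left hφ1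
  have hp1 : Tendsto (fun n => p (n + 1)) φ (𝓝 0) :=
    (hplim.comp (tendsto_add_atTop_nat 1)).mono_left hφ1
  have hnorm : ∀ {c : ℕ → ℂ} {l : ℂ}, Tendsto c φ (𝓝 l) →
      Tendsto (fun n => 1 - normSq (c n)) φ (𝓝 0) → normSq l = 1 := by
    intro c l hc hc0
    have := tendsto_nhds_unique hc0 (((continuous_normSq.tendsto l).comp hc).const_sub 1)
    linarith
  have hτ1 : normSq τ = 1 := hnorm hτ hp0
  -- The self-map does not increase the pseudohyperbolic distance of consecutive orbit points, so
  -- `1` minus its square stays at least `δ > 0`. As both points tend to the circle, their limits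
  -- coincide.
  have hττ' : conj τ * τ' = 1 := by
    have hδ : ∀ n, p 0 * horo (a 0) (a 1) ≤ p n * horo (a n) (a (n + 1)) := by
      intro n
      induction n with
      | zero => exact le_rfl
      | succ n ih =>
        have := horo_mul_le_horo_mul hkd hkm (ha n) (ha (n + 1))
        rw [hka, hka] at this
        exact ih.trans this
    set δ := p 0 * horo (a 0) (a 1) with hδdef
    have hδ0 : 0 < δ := mul_pos (hp 0)
      (div_pos (hp 1) (normSq_pos.2 (one_sub_conj_mul_ne_zero (ha 0) (ha 1))))
    have h1 : ∀ n, δ * normSq (1 - conj (a n) * a (n + 1)) ≤ p n * p (n + 1) := by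
      intro n
      have h2 := hδ n
      rw [horo, ← mul_div_assoc, le_div_iff₀
        (normSq_pos.2 (one_sub_conj_mul_ne_zero (ha n) (ha (n + 1))))] at h2
      exact h2
    have h2 : Tendsto (fun n => δ * normSq (1 - conj (a n) * a (n + 1))) φ
        (𝓝 (δ * normSq (1 - conj τ * τ'))) :=
      ((continuous_normSq.tendsto _).comp
        ((((continuous_conj.tendsto τ).comp hτ).mul hτ').const_sub 1)).const_mul δ
    have h3 := le_of_tendsto_of_tendsto' h2 (hp0.mul hp1) h1
    rw [mul_zero] at h3
    have h4 : normSq (1 - conj τ * τ') = 0 :=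
      le_antisymm (by by_contra! hcon; exact absurd h3 (not_le.2 (mul_pos hδ0 hcon)))
        (normSq_nonneg _)
    exact (sub_eq_zero.1 (normSq_eq_zero.1 h4)).symm
  have hτeq : τ' = τ := by
    have h1 : τ * conj τ = 1 := by rw [mul_conj, hτ1, ofReal_one]
    calc τ' = (τ * conj τ) * τ' := by rw [h1, one_mul]
      _ = τ * (conj τ * τ') := by ring
      _ = τ := by rw [hττ', mul_one]
  rw [hτeq] at hτ'
  have hτn : ‖τ‖ = 1 := by
    rw [normSq_eq_norm_sq] at hτ1
    exact (pow_eq_one_iff_of_nonneg (norm_nonneg τ) two_ne_zero).1 hτ1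
  refine ⟨τ, hτn, fun w hw => ?_⟩
  have hGw := hG.norm_lt_one w hw
  have hGw' := hG.norm_lt_one _ (h.sub_mem hw ht.le)
  have hcont : ∀ {c : ℕ → ℂ} {z : ℂ}, ‖z‖ < 1 → Tendsto c φ (𝓝 τ) →
      Tendsto (fun n => horo (c n) z) φ (𝓝 (horo τ z)) := by
    intro c z hz hc
    refine Tendsto.div tendsto_const_nhds ((continuous_normSq.tendsto _).comp
        ((((continuous_conj.tendsto τ).comp hc).mul_const z).const_sub 1)) ?_
    exact (normSq_pos.2 (one_sub_conj_mul_ne_zero_of_norm_eq_one hτn hz)).ne'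
  refine le_of_tendsto_of_tendsto (hcont hGw hτ) (hcont hGw' hτ') ?_
  filter_upwards [hφ2] with n hn
  have h1 := horo_mul_le_horo_mul hkd hkm (ha n) hGw
  rw [hka, hk w hw] at h1
  have h2 : 0 ≤ horo (a (n + 1)) (G (w - t)) :=
    div_nonneg (sub_nonneg.2 (normSq_lt_one_iff.2 hGw').le) (normSq_nonneg _)
  have h3 : p n * horo (a n) (G w) ≤ p n * horo (a (n + 1)) (G (w - t)) :=
    h1.trans (mul_le_mul_of_nonneg_right hn h2)
  exact le_of_mul_le_mul_left h3 (hp n)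

lemma horo_le_sub_nat_mul (h : IsStarlikeAtNegInfty Ω) {τ : ℂ} {t : ℝ} (ht : 0 ≤ t)
    (hτ : ∀ w ∈ Ω, horo τ (G w) ≤ horo τ (G (w - t))) (n : ℕ) :
    ∀ w ∈ Ω, horo τ (G w) ≤ horo τ (G (w - (n * t : ℝ))) := by
  induction n with
  | zero => intro w _; simp
  | succ n ih =>
    intro w hw
    have h1 := hτ _ (h.sub_mem hw (t := n * t) (by positivity))
    have h2 : w - ((n + 1 : ℕ) * t : ℝ) = w - (n * t : ℝ) - t := by push_cast; ring
    rw [h2]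
    exact (ih w hw).trans h1

/-- The common **Wolff point** of the semigroup conjugate to the translations of `Ω`. -/
theorem IsStarlikeAtNegInfty.exists_wolff_point (h : IsStarlikeAtNegInfty Ω)
    (hG : IsDiscEmbedding G Ω) (hGΩ : G '' Ω = ball 0 1) :
    ∃ τ : ℂ, ‖τ‖ = 1 ∧ ∀ w ∈ Ω, ∀ j : ℕ,
      horo τ (G w) ≤ horo τ (G (w - ((1 / 2 : ℝ) ^ j : ℝ))) := by
  have key : ∀ j : ℕ, ∃ τ : ℂ, ‖τ‖ = 1 ∧
      ∀ w ∈ Ω, horo τ (G w) ≤ horo τ (G (w - ((1 / 2 : ℝ) ^ j : ℝ))) := fun j =>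
    h.exists_horo_le hG hGΩ (by positivity)
  choose σ hσ1 hσ using key
  -- The point `σ n` for step `2⁻ⁿ` also serves every `2⁻ʲ` with `j ≤ n`, by iterating `2ⁿ⁻ʲ` times.
  -- A limit of the `σ n` therefore serves all `j`.
  obtain ⟨τ, hτ, hlim⟩ := (isCompact_sphere (0 : ℂ) 1).ultrafilter_le_nhds
    ((hyperfilter ℕ).map σ) (by
      rw [Ultrafilter.coe_map, le_principal_iff, mem_map]
      exact univ_mem' fun n => by simpa using hσ1 n)
  have hτ1 : ‖τ‖ = 1 := by simpa using hτ
  have hlim' : Tendsto σ (hyperfilter ℕ) (𝓝 τ) := hlim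
  have hle : (hyperfilter ℕ : Filter ℕ) ≤ atTop := by
    rw [← Nat.cofinite_eq_atTop]
    exact hyperfilter_le_cofinite
  have hcont : ∀ {z : ℂ}, ‖z‖ < 1 →
      Tendsto (fun n => horo (σ n) z) (hyperfilter ℕ) (𝓝 (horo τ z)) := by
    intro z hz
    refine Tendsto.div tendsto_const_nhds ((continuous_normSq.tendsto _).comp
        ((((continuous_conj.tendsto τ).comp hlim').mul_const z).const_sub 1)) ?_
    exact (normSq_pos.2 (one_sub_conj_mul_ne_zero_of_norm_eq_one hτ1 hz)).ne'
  refine ⟨τ, hτ1, fun w hw j => ?_⟩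
  refine le_of_tendsto_of_tendsto (hcont (hG.norm_lt_one w hw))
    (hcont (hG.norm_lt_one _ (h.sub_mem hw (by positivity)))) ?_
  filter_upwards [hle (eventually_ge_atTop j)] with n hn
  have h1 := horo_le_sub_nat_mul h (by positivity) (hσ n) (2 ^ (n - j)) w hw
  have h2 : (((2 ^ (n - j) : ℕ) : ℝ) * (1 / 2) ^ n : ℝ) = (1 / 2) ^ j := by
    obtain ⟨m, rfl⟩ := Nat.exists_eq_add_of_le hn
    rw [Nat.add_sub_cancel_left, pow_add, mul_comm ((1 / 2 : ℝ) ^ j), ← mul_assoc]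
    push_cast
    rw [← mul_pow]
    norm_num
  rwa [h2] at h1

end WolffPoint

/-! ### Passage to the half-plane and the converse -/

/-- The Cayley transform of the unit disc onto the upper half-plane that sends `τ` to `∞`. -/
noncomputable def discToHalfPlane (τ z : ℂ) : ℂ := I * (1 + conj τ * z) / (1 - conj τ * z)

section Cayley

variable {τ : ℂ}

/-- Turns horodiscs at `τ` into half-planes, so that their invariance becomes monotonicity of an
imaginary part. -/
lemma im_discToHalfPlane (hτ : ‖τ‖ = 1) {z : ℂ} (hz : ‖z‖ < 1) :
    (discToHalfPlane τ z).im = horo τ z := by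
  have h1 := normSq_pos.2 (one_sub_conj_mul_ne_zero_of_norm_eq_one hτ hz)
  have h2 : normSq (conj τ * z) = normSq z := by
    rw [normSq_mul, normSq_conj, normSq_eq_norm_sq τ, hτ]
    ring
  rw [horo, ← h2, discToHalfPlane]
  generalize conj τ * z = u at *
  rw [div_im]
  field_simp
  simp [normSq_apply]
  ring

lemma hasDerivAt_discToHalfPlane (hτ : ‖τ‖ = 1) {z : ℂ} (hz : ‖z‖ < 1) :
    HasDerivAt (discToHalfPlane τ) (2 * I * conj τ / (1 - conj τ * z) ^ 2) z := by
  have h := one_sub_conj_mul_ne_zero_of_norm_eq_one hτ hz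
  have h0 : HasDerivAt (fun z : ℂ => conj τ * z) (conj τ * 1) z :=
    (hasDerivAt_id z).const_mul (conj τ)
  convert! ((h0.const_add 1).const_mul I).div (h0.const_sub 1) h using 1
  ring

lemma discToHalfPlane_injOn (hτ : ‖τ‖ = 1) : InjOn (discToHalfPlane τ) (ball 0 1) := by
  intro z hz w hw heq
  rw [mem_ball_zero_iff] at hz hw
  have hτ0 : conj τ ≠ 0 := by
    rw [← norm_ne_zero_iff, RCLike.norm_conj, hτ]
    exact one_ne_zero
  rw [discToHalfPlane, discToHalfPlane,
    div_eq_div_iff (one_sub_conj_mul_ne_zero_of_norm_eq_one hτ hz)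
      (one_sub_conj_mul_ne_zero_of_norm_eq_one hτ hw)] at heq
  refine mul_left_cancel₀ (mul_ne_zero (mul_ne_zero two_ne_zero I_ne_zero) hτ0) ?_
  linear_combination heq

lemma discToHalfPlane_image (hτ : ‖τ‖ = 1) :
    discToHalfPlane τ '' ball 0 1 = UpperHalfPlane.upperHalfPlaneSet := by
  apply Subset.antisymm
  · rintro _ ⟨z, hz, rfl⟩
    rw [mem_ball_zero_iff] at hz
    change 0 < (discToHalfPlane τ z).im
    rw [im_discToHalfPlane hτ hz]
    exact div_pos (sub_pos.2 (normSq_lt_one_iff.2 hz))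
      (normSq_pos.2 (one_sub_conj_mul_ne_zero_of_norm_eq_one hτ hz))
  · intro z hz
    have hz0 : 0 < z.im := hz
    have hzI : z + I ≠ 0 := by
      intro h0
      have := congrArg im h0
      simp at this
      linarith
    have hττ : conj τ * τ = 1 := by rw [conj_mul', hτ]; simp
    refine ⟨τ * ((z - I) / (z + I)), ?_, ?_⟩
    · rw [mem_ball_zero_iff, norm_mul, hτ, one_mul, ← normSq_lt_one_iff, normSq_div,
        div_lt_one (normSq_pos.2 hzI)]
      simp [normSq_apply]
      nlinarith
    · rw [discToHalfPlane, ← mul_assoc, hττ, one_mul, div_eq_iff]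
      · field_simp
        ring
      · rw [one_sub_div hzI]
        refine div_ne_zero ?_ hzI
        rw [show z + I - (z - I) = 2 * I by ring]
        exact mul_ne_zero two_ne_zero I_ne_zero

end Cayley

theorem IsStarlikeAtNegInfty.exists_isNevanlinna {Ω : Set ℂ} (h : IsStarlikeAtNegInfty Ω) :
    ∃ ψ Ψ : ℂ → ℂ, IsNevanlinna ψ ∧ (∃ z ∈ UpperHalfPlane.upperHalfPlaneSet, ψ z ≠ 0) ∧
      IsPrimitiveOnUpperHalf Ψ (fun z => -ψ z) ∧ Ω = Ψ '' UpperHalfPlane.upperHalfPlaneSet := by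
  obtain ⟨G, hG, hGΩ⟩ := h.exists_riemann_map
  obtain ⟨τ, hτ, hwolff⟩ := h.exists_wolff_point hG hGΩ
  have hτ0 : conj τ ≠ 0 := by
    rw [← norm_ne_zero_iff, RCLike.norm_conj, hτ]
    exact one_ne_zero
  let g : ℂ → ℂ := fun w => discToHalfPlane τ (G w)
  let g' : ℂ → ℂ := fun w => 2 * I * conj τ / (1 - conj τ * G w) ^ 2 * deriv G w
  have hgd : ∀ w ∈ Ω, HasDerivAt g (g' w) w := fun w hw =>
    (hasDerivAt_discToHalfPlane hτ (hG.norm_lt_one w hw)).comp w (hG.hasDerivAt h.isOpen hw)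
  have hg0 : ∀ w ∈ Ω, g' w ≠ 0 := fun w hw => mul_ne_zero
    (div_ne_zero (mul_ne_zero (mul_ne_zero two_ne_zero I_ne_zero) hτ0)
      (pow_ne_zero 2 (one_sub_conj_mul_ne_zero_of_norm_eq_one hτ (hG.norm_lt_one w hw))))
    (hG.deriv_ne_zero w hw)
  have hginj : InjOn g Ω := (discToHalfPlane_injOn hτ).comp hG.injOn fun w hw => by
    simpa using hG.norm_lt_one w hw
  have hgim : g '' Ω = UpperHalfPlane.upperHalfPlaneSet := by
    rw [← discToHalfPlane_image hτ, ← hGΩ, image_image]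
  have hgle : ∀ w ∈ Ω, (g' w).im ≤ 0 := by
    intro w hw
    -- As `g` is differentiable, its derivative is the limit of slopes along `w - 2⁻ʲ`. Each slope
    -- is a negative real times an increment with nonnegative imaginary part.
    have hlim : Tendsto (fun j : ℕ => w - ((1 / 2 : ℝ) ^ j : ℝ)) atTop (𝓝[≠] w) := by
      rw [tendsto_nhdsWithin_iff]
      constructor
      · have h1 : Tendsto (fun j : ℕ => (((1 / 2 : ℝ) ^ j : ℝ) : ℂ)) atTop (𝓝 ((0 : ℝ) : ℂ)) :=
          (continuous_ofReal.tendsto 0).comp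
            (tendsto_pow_atTop_nhds_zero_of_lt_one (by norm_num) (by norm_num))
        simpa using h1.const_sub w
      · refine Eventually.of_forall fun j hj => ?_
        have h1 : (((1 / 2 : ℝ) ^ j : ℝ) : ℂ) = 0 := sub_eq_self.1 hj
        rw [ofReal_eq_zero] at h1
        exact (by positivity : (1 / 2 : ℝ) ^ j ≠ 0) h1
    have h1 := ((hasDerivAt_iff_tendsto_slope.1 (hgd w hw)).comp hlim)
    refine le_of_tendsto ((continuous_im.tendsto _).comp h1) (Eventually.of_forall fun j => ?_)
    have h2 : (0 : ℝ) < (1 / 2) ^ j := by positivity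
    have h3 := hwolff w hw j
    rw [← im_discToHalfPlane hτ (hG.norm_lt_one w hw),
      ← im_discToHalfPlane hτ (hG.norm_lt_one _ (h.sub_mem hw h2.le))] at h3
    have h4 : slope g w (w - ((1 / 2 : ℝ) ^ j : ℝ)) =
        ((-((1 / 2 : ℝ) ^ j)⁻¹ : ℝ) : ℂ) * (g (w - ((1 / 2 : ℝ) ^ j : ℝ)) - g w) := by
      rw [slope_def_module, sub_sub_cancel_left, smul_eq_mul]
      push_cast
      rw [inv_neg]
    simp only [Function.comp_apply]
    rw [h4, im_ofReal_mul, sub_im]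
    exact mul_nonpos_of_nonpos_of_nonneg (neg_nonpos.2 (inv_pos.2 h2).le) (sub_nonneg.2 h3)
  let Ψ := Function.invFunOn g Ω
  have hΨd : ∀ z ∈ UpperHalfPlane.upperHalfPlaneSet,
      ∃ w ∈ Ω, Ψ z = w ∧ HasDerivAt Ψ (g' w)⁻¹ z := by
    rw [← hgim]
    rintro _ ⟨w, hw, rfl⟩
    exact ⟨w, hw, hginj.leftInvOn_invFunOn hw, hasDerivAt_invFunOn h.isOpen hgd hg0 hginj hw⟩
  have hΨdiff : DifferentiableOn ℂ Ψ UpperHalfPlane.upperHalfPlaneSet := fun z hz => by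
    obtain ⟨w, -, -, hd⟩ := hΨd z hz
    exact hd.differentiableAt.differentiableWithinAt
  have hH := UpperHalfPlane.isOpen_upperHalfPlaneSet
  refine ⟨fun z => -deriv Ψ z, Ψ, ⟨?_, fun z hz => ?_⟩, ⟨I, ?_, ?_⟩, fun z hz => ?_, ?_⟩
  · exact (hΨdiff.deriv hH).fun_neg.analyticOnNhd hH
  · obtain ⟨w, hw, -, hd⟩ := hΨd z hz
    rw [hd.deriv, neg_im, inv_im]
    exact neg_nonpos.2 (div_nonneg (neg_nonneg.2 (hgle w hw)) (normSq_nonneg _))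
  · simp [UpperHalfPlane.upperHalfPlaneSet]
  · obtain ⟨w, hw, -, hd⟩ := hΨd I (by simp [UpperHalfPlane.upperHalfPlaneSet])
    simp only [hd.deriv]
    exact neg_ne_zero.2 (inv_ne_zero (hg0 w hw))
  · simp only [neg_neg]
    exact (hΨdiff.differentiableAt (hH.mem_nhds hz)).hasDerivAt
  · rw [← hgim]
    exact (hginj.leftInvOn_invFunOn.image_image).symm

theorem mainTheorem4 :
    (∀ ψ Ψ : ℂ → ℂ, IsNevanlinna ψ → (∃ z ∈ UpperHalfPlane.upperHalfPlaneSet, ψ z ≠ 0) →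
      IsPrimitiveOnUpperHalf Ψ (fun z => -ψ z) →
        IsStarlikeAtNegInfty (Ψ '' UpperHalfPlane.upperHalfPlaneSet)) ∧
    (∀ Ω : Set ℂ, IsStarlikeAtNegInfty Ω →
      ∃ ψ Ψ : ℂ → ℂ, IsNevanlinna ψ ∧ (∃ z ∈ UpperHalfPlane.upperHalfPlaneSet, ψ z ≠ 0) ∧
        IsPrimitiveOnUpperHalf Ψ (fun z => -ψ z) ∧ Ω = Ψ '' UpperHalfPlane.upperHalfPlaneSet) :=
  ⟨fun _ _ hψ hne hΨ => hψ.isStarlikeAtNegInfty_image hne hΨ, fun _ hΩ => hΩ.exists_isNevanlinna⟩
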